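/- Let $Q$ be a (Hausdorff, finite-dimensional) smooth manifold and $k\ge 1$. Let $T^mQ=J^m_0(\mathbb R,Q)$ be the $m$-th order tangent bundle (the $m$-jets at $0$ of smooth curves in $Q$), with natural coordinates $(q_0^A,\dots,q_m^A)$, $q_i^A=\frac{d^i\sigma^A}{dt^i}(0)$, projections $\rho^m_r:T^mQ\to T^rQ$ for $r\le m$, and canonical injection $j_k:T^{2k-1}Q\to T(T^{k-1}Q)$ sending the jet of $\sigma$ to the velocity at $t=0$ of the lifted curve $t\mapsto\tilde\sigma^{k-1}(t)$. Let $\mathcal L\in C^\infty(T^kQ)$. Let $J_r$ be the $r$-th vertical endomorphism, $J_r=\sum_{i}\frac{(r+i)!}{i!}\,dq_i^A\otimes\frac{\partial}{\partial q_{r+i}^A}$, let $d_{J_r}\mathcal L=d\mathcal L\circ J_r$, and let $d_T$ be Tulczyjew's derivation (for functions $d_Tf=\sum_i q_{i+1}^A\,\partial f/\partial q_i^A$, and $d_T(dq_i^A)=dq_{i+1}^A$). The Lagrangian $1$-form on $T^{2k-1}Q$ is $$\theta_{\mathcal L}=\sum_{r=1}^k(-1)^{r-1}\frac1{r!}\,d_T^{\,r-1}d_{J_r}\mathcal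 L ,$$ and the Legendre–Ostrogradsky map $\mathcal{FL}:T^{2k-1}Q\to T^*(T^{k-1}Q)$ is the map over $\rho^{2k-1}_{k-1}$ with $\theta_{\mathcal L}(u)=\langle \mathcal{FL}(p),T\rho^{2k-1}_{k-1}(u)\rangle$ for all $p\in T^{2k-1}Q$ and $u\in T_p(T^{2k-1}Q)$. Let $\mathcal W=T^{2k-1}Q\times_{T^{k-1}Q}T^*(T^{k-1}Q)$ with projections $\mathrm{pr}_1,\mathrm{pr}_2$, let $\Omega=\mathrm{pr}_2^*\omega_{k-1}$, where $\omega_{k-1}$ is the canonical symplectic form of $T^*(T^{k-1}Q)$, let $\mathcal C(p,\alpha)=\langle\alpha,j_k(p)\rangle$ and $H=\mathcal C-(\rho^{2k-1}_k\circ\mathrm{pr}_1)^*\mathcal L$. Let $$\mathcal W_c=\{w\in\mathcal W:\ (i(Y)dH)(w)=0\ \text{ for every } Y\in\ker\Omega\},$$ where $\ker\Omega$ is the set of smooth vector fields $Y$ on $\mathcal W$ with $i(Y)\Omega=0$. Then $\mathcal W_c$ is an embedded smooth submanifold of $\mathcal W$; the Legendre–Ostrogradsky map $\mathcal{FL}$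 exists, is unique and is smooth; and its graph $$\mathcal W_o=\mathrm{graph}\,\mathcal{FL}=\{w\in\mathcal W:\ \mathrm{pr}_2(w)=\mathcal{FL}(\mathrm{pr}_1(w))\}$$ is contained in $\mathcal W_c$ and is an embedded smooth submanifold of $\mathcal W_c$. -/

import Mathlib

open Set Bundle Topology
open scoped Manifold ContDiff

noncomputable section
namespace SkinnerRusk

section Calculus
variable {E : Type*} [NormedAddCommGroup E] [NormedSpace ℝ E]

theorem iteratedDeriv_comp_congr {g : E → E} {c d : ℝ → E} {m : ℕ}
    (hg : ContDiffAt ℝ ∞ g (c 0)) (hc : ContDiffAt ℝ ∞ c 0) (hd : ContDiffAt ℝ ∞ d 0)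
    (h : ∀ i ≤ m, iteratedDeriv i c 0 = iteratedDeriv i d 0) :
    ∀ i ≤ m, iteratedDeriv i (g ∘ c) 0 = iteratedDeriv i (g ∘ d) 0 := by
  intro i hi
  have h0 : c 0 = d 0 := by simpa using h 0 (Nat.zero_le _)
  have hle : (i : WithTop ℕ∞) ≤ ∞ := by exact_mod_cast le_top
  rw [iteratedDeriv_eq_iteratedFDeriv, iteratedDeriv_eq_iteratedFDeriv,
    iteratedFDeriv_comp hg hc hle, iteratedFDeriv_comp (h0 ▸ hg) hd hle, ← h0]
  congr 1
  refine Finset.sum_congr rfl fun P _ => ?_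
  unfold FormalMultilinearSeries.compAlongOrderedFinpartition
  congr 1
  funext l
  ext
  have hl : P.partSize l ≤ m := (P.partSize_le l).trans hi
  simp only [ftaylorSeries]
  rw [iteratedFDeriv_apply_eq_iteratedDeriv_mul_prod,
    iteratedFDeriv_apply_eq_iteratedDeriv_mul_prod, h _ hl]

/-- The polynomial curve with prescribed derivatives at `0`. -/
def taylorCurve {m : ℕ} (q : Fin (m + 1) → E) (t : ℝ) : E :=
  ∑ i : Fin (m + 1), (t ^ (i : ℕ) / ((i : ℕ).factorial : ℝ)) • q i

theorem contDiff_taylorCurve_uncurry (m : ℕ) :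
    ContDiff ℝ ∞ (fun z : (Fin (m + 1) → E) × ℝ => taylorCurve z.1 z.2) := by
  unfold taylorCurve
  fun_prop

theorem contDiff_taylorCurve {m : ℕ} (q : Fin (m + 1) → E) : ContDiff ℝ ∞ (taylorCurve q) := by
  unfold taylorCurve
  fun_prop

theorem iteratedDeriv_taylorCurve {m : ℕ} (q : Fin (m + 1) → E) (i : Fin (m + 1)) :
    iteratedDeriv i (taylorCurve q) 0 = q i := by
  unfold taylorCurve
  rw [iteratedDeriv_fun_sum (fun j _ => by fun_prop), Finset.sum_eq_single i]
  · rw [iteratedDeriv_smul_const (f := fun t : ℝ => t ^ (i : ℕ) / ((i : ℕ).factorial : ℝ))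
      (by fun_prop)]
    simp only [div_eq_mul_inv, mul_comm _ ((_ : ℝ)⁻¹), iteratedDeriv_const_mul_field,
      iteratedDeriv_fun_pow_zero]
    simp [Nat.factorial_ne_zero]
  · intro j _ hj
    rw [iteratedDeriv_smul_const (f := fun t : ℝ => t ^ (j : ℕ) / ((j : ℕ).factorial : ℝ))
      (by fun_prop)]
    simp only [div_eq_mul_inv, mul_comm _ ((_ : ℝ)⁻¹), iteratedDeriv_const_mul_field,
      iteratedDeriv_fun_pow_zero]
    have : (i : ℕ) ≠ j := fun h => hj (Fin.ext h.symm)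
    simp [this]
  · simp

theorem taylorCurve_zero {m : ℕ} (q : Fin (m + 1) → E) : taylorCurve q 0 = q 0 := by
  simpa using iteratedDeriv_taylorCurve q 0

/-- Iterated partial derivatives of a smooth function of `(x, t)` are smooth. -/
theorem contDiffOn_iteratedDeriv_snd {X : Type*} [NormedAddCommGroup X] [NormedSpace ℝ X]
    {G : X × ℝ → E} {U : Set (X × ℝ)} (hU : IsOpen U) (hG : ContDiffOn ℝ ∞ G U) (i : ℕ) :
    ContDiffOn ℝ ∞ (fun z : X × ℝ => iteratedDeriv i (fun t => G (z.1, t)) z.2) U := by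
  induction i with
  | zero => simpa using hG
  | succ i ih =>
    have hf := ih.fderiv_of_isOpen hU (m := ∞) (by simp)
    refine (hf.clm_apply (contDiffOn_const (c := ((0 : X), (1 : ℝ))))).congr ?_
    rintro ⟨x, t⟩ hz
    have hd : DifferentiableAt ℝ
        (fun z : X × ℝ => iteratedDeriv i (fun t => G (z.1, t)) z.2) (x, t) :=
      (ih.contDiffAt (hU.mem_nhds hz)).differentiableAt (by simp)
    have := hd.hasFDerivAt.comp_hasDerivAt t ((hasDerivAt_const t x).prodMk (hasDerivAt_id t))
    rw [iteratedDeriv_succ]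
    exact this.deriv

end Calculus

section Jets
variable (E : Type*) [NormedAddCommGroup E] [NormedSpace ℝ E]
variable (Q : Type*) [TopologicalSpace Q] [ChartedSpace E Q]

/-- Smooth curves `σ : ℝ → Q`. -/
abbrev Curve := C^∞⟮𝓘(ℝ, ℝ), ℝ; 𝓘(ℝ, E), Q⟯

variable {E Q}

/-- Two curves have the same `m`-jet at `0`: they pass through the same point at `0` and, in the
preferred chart of `Q` at that point, their derivatives at `0` agree up to order `m`. -/
def SameJet (m : ℕ) (σ τ : Curve E Q) : Prop :=
  σ 0 = τ 0 ∧ ∀ i ≤ m, iteratedDeriv i (chartAt E (σ 0) ∘ σ) 0 =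
    iteratedDeriv i (chartAt E (σ 0) ∘ τ) 0

variable (E Q) in
/-- Equality of `m`-jets at `0` as an equivalence relation. -/
def jetSetoid (m : ℕ) : Setoid (Curve E Q) where
  r := SameJet m
  iseqv :=
    { refl := fun _ => ⟨rfl, fun _ _ => rfl⟩
      symm := fun {σ τ} h => ⟨h.1.symm, fun i hi => by rw [← h.1]; exact (h.2 i hi).symm⟩
      trans := fun {σ τ υ} h h' => ⟨h.1.trans h'.1, fun i hi =>
        (h.2 i hi).trans (by rw [h.1]; exact h'.2 i hi)⟩ }

variable (E Q) in
/-- The `m`-th order tangent bundle `T^m Q = J_0^m(ℝ, Q)`: the `m`-jets at `0 ∈ ℝ` of smooth curves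
in `Q`. -/
def JetBundle (m : ℕ) : Type _ := Quotient (jetSetoid E Q m)

/-- The `m`-jet `σ̃^m(0)` of a curve `σ`. -/
def jet (m : ℕ) (σ : Curve E Q) : JetBundle E Q m := Quotient.mk (jetSetoid E Q m) σ

/-- A curve representing a given jet. -/
def JetBundle.curve {m : ℕ} (p : JetBundle E Q m) : Curve E Q := Quotient.out p

theorem jet_curve {m : ℕ} (p : JetBundle E Q m) : jet m p.curve = p := Quotient.out_eq p

theorem sameJet_curve_jet (m : ℕ) (σ : Curve E Q) : SameJet m (jet m σ).curve σ :=
  Quotient.exact (jet_curve (jet m σ))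

theorem jet_eq_iff {m : ℕ} {σ τ : Curve E Q} : jet m σ = jet m τ ↔ SameJet m σ τ :=
  ⟨fun h => Quotient.exact h, fun h => Quotient.sound h⟩

theorem SameJet.mono {m r : ℕ} (h : r ≤ m) {σ τ : Curve E Q} (hs : SameJet m σ τ) :
    SameJet r σ τ := ⟨hs.1, fun i hi => hs.2 i (hi.trans h)⟩

/-- The projection `β^m : T^m Q → Q`, `σ̃^m(0) ↦ σ(0)`. -/
def JetBundle.base {m : ℕ} (p : JetBundle E Q m) : Q := p.curve 0

theorem base_jet (m : ℕ) (σ : Curve E Q) : (jet m σ).base = σ 0 := (sameJet_curve_jet m σ).1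

/-- The translated curve `σ_t(s) = σ(s + t)`. -/
def Curve.shift (σ : Curve E Q) (t : ℝ) : Curve E Q :=
  σ.comp ⟨fun s => s + t, (contDiff_id.add contDiff_const).contMDiff⟩

/-- The canonical lifting `t ↦ σ̃^m(t)` of a curve `σ` to `T^m Q`: the `m`-jet of `σ_t`. -/
def jetLift (m : ℕ) (σ : Curve E Q) (t : ℝ) : JetBundle E Q m := jet m (σ.shift t)

theorem jetLift_zero (m : ℕ) (σ : Curve E Q) : jetLift m σ 0 = jet m σ := by
  unfold jetLift
  congr 1
  ext t
  change σ (t + 0) = σ t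
  rw [add_zero]

/-- The projection `ρ^m_r : T^m Q → T^r Q`, `σ̃^m(0) ↦ σ̃^r(0)`, for `r ≤ m`, as a map of sets. -/
def jetProjFun {m r : ℕ} (_h : r ≤ m) (p : JetBundle E Q m) : JetBundle E Q r := jet r p.curve

theorem jetProjFun_jet {m r : ℕ} (h : r ≤ m) (σ : Curve E Q) :
    jetProjFun h (jet m σ) = jet r σ :=
  jet_eq_iff.2 ((sameJet_curve_jet m σ).mono h)

variable [IsManifold 𝓘(ℝ, E) ∞ Q]

theorem contDiffAt_chart_comp {φ : OpenPartialHomeomorph Q E} (hφ : φ ∈ atlas E Q)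
    (σ : Curve E Q) {t : ℝ} (ht : σ t ∈ φ.source) : ContDiffAt ℝ ∞ (φ ∘ σ) t := by
  rw [← contMDiffAt_iff_contDiffAt]
  exact (contMDiffAt_of_mem_maximalAtlas
    (IsManifold.subset_maximalAtlas hφ) ht).comp t σ.contMDiff.contMDiffAt

theorem contDiffOn_transition {φ ψ : OpenPartialHomeomorph Q E} (hφ : φ ∈ atlas E Q)
    (hψ : ψ ∈ atlas E Q) : ContDiffOn ℝ ∞ (ψ ∘ φ.symm) (φ.target ∩ φ.symm ⁻¹' ψ.source) := by
  rw [← contMDiffOn_iff_contDiffOn]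
  exact (contMDiffOn_of_mem_maximalAtlas (I := 𝓘(ℝ, E)) (n := ∞)
    (IsManifold.subset_maximalAtlas hψ)).comp
    ((contMDiffOn_symm_of_mem_maximalAtlas (I := 𝓘(ℝ, E)) (n := ∞)
    (IsManifold.subset_maximalAtlas hφ)).mono inter_subset_left) (fun x hx => hx.2)

theorem iteratedDeriv_chart_congr {m : ℕ} {φ ψ : OpenPartialHomeomorph Q E} (hφ : φ ∈ atlas E Q)
    (hψ : ψ ∈ atlas E Q) {σ τ : Curve E Q} (h0 : σ 0 = τ 0) (hσφ : σ 0 ∈ φ.source)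
    (hσψ : σ 0 ∈ ψ.source)
    (h : ∀ i ≤ m, iteratedDeriv i (φ ∘ σ) 0 = iteratedDeriv i (φ ∘ τ) 0) :
    ∀ i ≤ m, iteratedDeriv i (ψ ∘ σ) 0 = iteratedDeriv i (ψ ∘ τ) 0 := by
  have key : ∀ υ : Curve E Q, υ 0 ∈ φ.source →
      ψ ∘ υ =ᶠ[𝓝 0] (ψ ∘ φ.symm) ∘ (φ ∘ υ) := by
    intro υ hυ
    have : ∀ᶠ t in 𝓝 (0 : ℝ), υ t ∈ φ.source :=
      υ.contMDiff.continuous.continuousAt.eventually (φ.open_source.mem_nhds hυ)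
    filter_upwards [this] with t ht
    simp [φ.left_inv ht]
  have hopen : IsOpen (φ.target ∩ φ.symm ⁻¹' ψ.source) :=
    φ.symm.isOpen_inter_preimage ψ.open_source
  have hmem : φ (σ 0) ∈ φ.target ∩ φ.symm ⁻¹' ψ.source :=
    ⟨φ.map_source hσφ, by simpa [φ.left_inv hσφ] using hσψ⟩
  have hg : ContDiffAt ℝ ∞ (ψ ∘ φ.symm) ((φ ∘ σ) 0) :=
    (contDiffOn_transition hφ hψ).contDiffAt (hopen.mem_nhds hmem)
  intro i hi
  rw [(key σ hσφ).iteratedDeriv_eq, (key τ (h0 ▸ hσφ)).iteratedDeriv_eq]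
  exact iteratedDeriv_comp_congr hg (contDiffAt_chart_comp hφ σ hσφ)
    (contDiffAt_chart_comp hφ τ (h0 ▸ hσφ)) h i hi

theorem SameJet.chart_eq {m : ℕ} {σ τ : Curve E Q} (hs : SameJet m σ τ)
    {φ : OpenPartialHomeomorph Q E} (hφ : φ ∈ atlas E Q) (hσ : σ 0 ∈ φ.source) :
    ∀ i ≤ m, iteratedDeriv i (φ ∘ σ) 0 = iteratedDeriv i (φ ∘ τ) 0 :=
  iteratedDeriv_chart_congr (chart_mem_atlas E (σ 0)) hφ hs.1 (mem_chart_source E _) hσ hs.2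

theorem sameJet_of_chart {m : ℕ} {σ τ : Curve E Q} {φ : OpenPartialHomeomorph Q E}
    (hφ : φ ∈ atlas E Q) (hσ : σ 0 ∈ φ.source) (hτ : τ 0 ∈ φ.source)
    (h : ∀ i ≤ m, iteratedDeriv i (φ ∘ σ) 0 = iteratedDeriv i (φ ∘ τ) 0) : SameJet m σ τ := by
  have h0 : σ 0 = τ 0 := φ.injOn hσ hτ (by simpa using h 0 (Nat.zero_le _))
  exact ⟨h0, iteratedDeriv_chart_congr hφ (chart_mem_atlas E (σ 0)) h0 hσ (mem_chart_source E _) h⟩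

theorem exists_curve {m : ℕ} {φ : OpenPartialHomeomorph Q E} (hφ : φ ∈ atlas E Q)
    (q : Fin (m + 1) → E) (hq : q 0 ∈ φ.target) :
    ∃ σ : Curve E Q, φ ∘ σ =ᶠ[𝓝 0] taylorCurve q ∧ σ 0 ∈ φ.source := by
  have hcont := (contDiff_taylorCurve q).continuous
  have hnhds : taylorCurve q ⁻¹' φ.target ∈ 𝓝 (0 : ℝ) :=
    hcont.continuousAt (φ.open_target.mem_nhds (by rwa [taylorCurve_zero]))
  obtain ⟨δ, hδ, hball⟩ := Metric.mem_nhds_iff.1 hnhds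
  let b : ContDiffBump (0 : ℝ) := ⟨δ / 4, δ / 2, by positivity, by linarith⟩
  let χ : ℝ → ℝ := fun t => b t * t
  have hχ : ContDiff ℝ ∞ χ := b.contDiff.mul contDiff_id
  have hχball : ∀ t, taylorCurve q (χ t) ∈ φ.target := by
    intro t
    apply hball
    rw [mem_ball_zero_iff]
    by_cases ht : t ∈ Metric.ball (0 : ℝ) (δ / 2)
    · rw [mem_ball_zero_iff] at ht
      have h1 : ‖b t‖ ≤ 1 := by
        rw [Real.norm_of_nonneg b.nonneg]; exact b.le_one
      calc ‖b t * t‖ = ‖b t‖ * ‖t‖ := norm_mul _ _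
        _ ≤ 1 * ‖t‖ := by gcongr
        _ < δ := by linarith
    · have : b t = 0 := b.zero_of_le_dist (by simpa using ht)
      simp [χ, this, hδ]
  have hχid : χ =ᶠ[𝓝 0] id := by
    filter_upwards [b.eventuallyEq_one] with t ht
    simp [χ, ht]
  have hs : ContMDiff 𝓘(ℝ, ℝ) 𝓘(ℝ, E) ∞ (fun t => φ.symm (taylorCurve q (χ t))) :=
    (contMDiffOn_symm_of_mem_maximalAtlas (I := 𝓘(ℝ, E)) (n := ∞)
      (IsManifold.subset_maximalAtlas hφ)).comp_contMDiff
      ((contDiff_taylorCurve q).comp hχ).contMDiff hχball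
  refine ⟨⟨_, hs⟩, ?_, ?_⟩
  · filter_upwards [hχid] with t ht
    have : φ (φ.symm (taylorCurve q (χ t))) = taylorCurve q (χ t) := φ.right_inv (hχball t)
    simpa [ht] using this
  · exact φ.map_target (hχball 0)

/-- Natural coordinates `(q_0, …, q_m)` on `T^m Q` induced by a chart `φ` of `Q`:
`q_i = d^i(φ ∘ σ)/dt^i (0)`. -/
def jetCoord (m : ℕ) (φ : OpenPartialHomeomorph Q E) (p : JetBundle E Q m) : Fin (m + 1) → E :=
  fun i => iteratedDeriv i (φ ∘ p.curve) 0

theorem jetCoord_jet {m : ℕ} {φ : OpenPartialHomeomorph Q E} (hφ : φ ∈ atlas E Q)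
    {σ : Curve E Q} (hσ : σ 0 ∈ φ.source) (i : Fin (m + 1)) :
    jetCoord m φ (jet m σ) i = iteratedDeriv i (φ ∘ σ) 0 := by
  have h := sameJet_curve_jet m σ
  exact h.chart_eq hφ (h.1 ▸ hσ) i (Nat.lt_succ_iff.1 i.2)

open Classical in
/-- The jet with given natural coordinates. -/
def jetOfCoord (m : ℕ) (φ : OpenPartialHomeomorph Q E) (q : Fin (m + 1) → E) : JetBundle E Q m :=
  if h : ∃ σ : Curve E Q, φ ∘ σ =ᶠ[𝓝 0] taylorCurve q ∧ σ 0 ∈ φ.source then jet m h.choose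
  else jet m (ContMDiffMap.const (φ.symm (q 0)))

theorem jetOfCoord_spec {m : ℕ} {φ : OpenPartialHomeomorph Q E} (hφ : φ ∈ atlas E Q)
    {q : Fin (m + 1) → E} (hq : q 0 ∈ φ.target) :
    ∃ σ : Curve E Q, (φ ∘ σ =ᶠ[𝓝 0] taylorCurve q ∧ σ 0 ∈ φ.source) ∧
      jetOfCoord m φ q = jet m σ := by
  have h := exists_curve hφ q hq
  exact ⟨h.choose, h.choose_spec, by rw [jetOfCoord, dif_pos h]⟩

/-- The natural chart of `T^m Q` induced by a chart `φ` of `Q`. -/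
def jetChart (m : ℕ) (φ : OpenPartialHomeomorph Q E) (hφ : φ ∈ atlas E Q) :
    PartialEquiv (JetBundle E Q m) (Fin (m + 1) → E) where
  toFun := jetCoord m φ
  invFun := jetOfCoord m φ
  source := {p | p.base ∈ φ.source}
  target := {q | q 0 ∈ φ.target}
  map_source' := fun p hp => by
    have : jetCoord m φ p 0 = φ p.base := by simp [jetCoord, JetBundle.base]
    rw [mem_ofPred_eq, this]
    exact φ.map_source hp
  map_target' := fun q hq => by
    obtain ⟨σ, hσ, h⟩ := jetOfCoord_spec hφ hq
    rw [mem_ofPred_eq, h, base_jet]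
    exact hσ.2
  left_inv' := fun p hp => by
    have h0 : jetCoord m φ p 0 = φ p.base := by simp [jetCoord, JetBundle.base]
    have hq : jetCoord m φ p 0 ∈ φ.target := by rw [h0]; exact φ.map_source hp
    obtain ⟨σ, hσ, h⟩ := jetOfCoord_spec hφ hq
    conv_rhs => rw [← jet_curve p]
    rw [h, jet_eq_iff]
    refine sameJet_of_chart hφ hσ.2 hp fun i hi => ?_
    rw [hσ.1.iteratedDeriv_eq]
    exact iteratedDeriv_taylorCurve _ ⟨i, Nat.lt_succ_iff.2 hi⟩
  right_inv' := fun q hq => by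
    obtain ⟨σ, hσ, h⟩ := jetOfCoord_spec hφ hq
    rw [h]
    funext i
    rw [jetCoord_jet hφ hσ.2, hσ.1.iteratedDeriv_eq, iteratedDeriv_taylorCurve]

theorem jetChart_trans_source {m : ℕ} {φ ψ : OpenPartialHomeomorph Q E}
    (hφ : φ ∈ atlas E Q) (hψ : ψ ∈ atlas E Q) :
    ((jetChart m φ hφ).symm.trans (jetChart m ψ hψ)).source =
      {q | q 0 ∈ φ.target ∩ φ.symm ⁻¹' ψ.source} := by
  ext q
  simp only [PartialEquiv.trans_source, PartialEquiv.symm_source, mem_inter_iff, mem_preimage,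
    mem_ofPred_eq]
  refine and_congr_right fun (hq : q 0 ∈ φ.target) => ?_
  obtain ⟨σ, hσ, h⟩ := jetOfCoord_spec hφ hq
  have h0 : φ (σ 0) = q 0 := by rw [← taylorCurve_zero q]; exact hσ.1.self_of_nhds
  change (jetOfCoord m φ q).base ∈ ψ.source ↔ _
  rw [h, base_jet, ← h0, φ.left_inv hσ.2]

theorem contDiffOn_jetChart_trans {m : ℕ} {φ ψ : OpenPartialHomeomorph Q E}
    (hφ : φ ∈ atlas E Q) (hψ : ψ ∈ atlas E Q) :
    ContDiffOn ℝ ∞ ((jetChart m φ hφ).symm.trans (jetChart m ψ hψ))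
      ((jetChart m φ hφ).symm.trans (jetChart m ψ hψ)).source := by
  rw [jetChart_trans_source, contDiffOn_pi]
  intro i
  have hopen : IsOpen (φ.target ∩ φ.symm ⁻¹' ψ.source) :=
    φ.symm.isOpen_inter_preimage ψ.open_source
  have hT := contDiff_taylorCurve_uncurry (E := E) m
  have hU := hopen.preimage hT.continuous
  have hG := contDiffOn_iteratedDeriv_snd hU
    ((contDiffOn_transition hφ hψ).comp hT.contDiffOn (fun z hz => hz)) i
  refine (hG.comp (f := fun q : Fin (m + 1) → E => (q, (0 : ℝ))) (by fun_prop) ?_).congr ?_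
  · intro q hq
    simpa [taylorCurve_zero] using hq
  · intro q hq
    obtain ⟨σ, hσ, h⟩ := jetOfCoord_spec hφ hq.1
    have h0 : φ (σ 0) = q 0 := by rw [← taylorCurve_zero q]; exact hσ.1.self_of_nhds
    have hσψ : σ 0 ∈ ψ.source := by rw [← φ.left_inv hσ.2, h0]; exact hq.2
    change jetCoord m ψ (jetOfCoord m φ q) i = _
    rw [h, jetCoord_jet hψ hσψ]
    refine Filter.EventuallyEq.iteratedDeriv_eq _ ?_
    have : ∀ᶠ t in 𝓝 (0 : ℝ), σ t ∈ φ.source :=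
      σ.contMDiff.continuous.continuousAt.eventually (φ.open_source.mem_nhds hσ.2)
    filter_upwards [this, hσ.1] with t ht ht'
    simp only [Function.comp_apply] at ht' ⊢
    rw [← ht', φ.left_inv ht]

variable (E Q) in
/-- The natural charts make `T^m Q` a charted space. -/
def jetChartedSpaceCore (m : ℕ) : ChartedSpaceCore (Fin (m + 1) → E) (JetBundle E Q m) where
  atlas := {e | ∃ (φ : OpenPartialHomeomorph Q E) (hφ : φ ∈ atlas E Q), e = jetChart m φ hφ}
  chartAt := fun p => jetChart m (chartAt E p.base) (chart_mem_atlas E p.base)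
  mem_chart_source := fun p => mem_chart_source E p.base
  chart_mem_atlas := fun p => ⟨_, _, rfl⟩
  open_source := by
    rintro _ _ ⟨φ, hφ, rfl⟩ ⟨ψ, hψ, rfl⟩
    rw [jetChart_trans_source]
    exact (φ.symm.isOpen_inter_preimage ψ.open_source).preimage (continuous_apply 0)
  continuousOn_toFun := by
    rintro _ _ ⟨φ, hφ, rfl⟩ ⟨ψ, hψ, rfl⟩
    exact (contDiffOn_jetChart_trans hφ hψ).continuousOn

instance (m : ℕ) : TopologicalSpace (JetBundle E Q m) :=
  (jetChartedSpaceCore E Q m).toTopologicalSpace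

instance (m : ℕ) : ChartedSpace (Fin (m + 1) → E) (JetBundle E Q m) :=
  (jetChartedSpaceCore E Q m).toChartedSpace

instance (m : ℕ) : IsManifold 𝓘(ℝ, Fin (m + 1) → E) ∞ (JetBundle E Q m) := by
  refine isManifold_of_contDiffOn _ _ _ ?_
  intro e e' he he'
  obtain ⟨_, ⟨e₁, rfl⟩, he⟩ := he
  obtain ⟨_, ⟨⟨φ, hφ, rfl⟩, rfl⟩, rfl⟩ := he
  obtain ⟨_, ⟨e₂, rfl⟩, he'⟩ := he'
  obtain ⟨_, ⟨⟨ψ, hψ, rfl⟩, rfl⟩, rfl⟩ := he'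
  have h := contDiffOn_jetChart_trans (m := m) hφ hψ
  simp only [modelWithCornersSelf_coe, modelWithCornersSelf_coe_symm, Function.id_comp,
    Function.comp_id, preimage_id_eq, range_id, inter_univ]
  exact h


theorem contMDiff_jetProjFun {m r : ℕ} (h : r ≤ m) :
    ContMDiff 𝓘(ℝ, Fin (m + 1) → E) 𝓘(ℝ, Fin (r + 1) → E) ∞
      (jetProjFun h : JetBundle E Q m → JetBundle E Q r) := by
  intro p
  have hbase : ∀ x : JetBundle E Q m, (jetProjFun h x).base = x.base := fun x => base_jet r _
  let c := chartAt (Fin (m + 1) → E) p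
  let c' := chartAt (Fin (r + 1) → E) (jetProjFun h p)
  let T : (Fin (m + 1) → E) → (Fin (r + 1) → E) := fun q i => q (i.castLE (by omega))
  have hT : ContDiff ℝ ∞ T := by fun_prop
  have hsrc : ∀ x ∈ c.source, jetProjFun h x ∈ c'.source ∧ c' (jetProjFun h x) = T (c x) := by
    intro x hx
    have hx' : x.base ∈ (chartAt E p.base).source := hx
    refine ⟨?_, ?_⟩
    · change (jetProjFun h x).base ∈ (chartAt E (jetProjFun h p).base).source
      rwa [hbase, hbase]
    · change jetCoord r (chartAt E (jetProjFun h p).base) (jet r x.curve) = _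
      rw [hbase]
      funext i
      exact jetCoord_jet (chart_mem_atlas E p.base) hx' i
  have hc : ContMDiffOn 𝓘(ℝ, Fin (m + 1) → E) 𝓘(ℝ, Fin (r + 1) → E) ∞
      (fun x => c'.symm (T (c x))) c.source := by
    refine (contMDiffOn_chart_symm (I := 𝓘(ℝ, Fin (r + 1) → E)) (n := ∞)).comp
      (hT.contMDiff.comp_contMDiffOn (contMDiffOn_chart (I := 𝓘(ℝ, Fin (m + 1) → E)))) ?_
    intro x hx
    change T (c x) ∈ c'.target
    rw [← (hsrc x hx).2]
    exact c'.map_source (hsrc x hx).1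
  refine (hc.congr fun x hx => ?_).contMDiffAt (c.open_source.mem_nhds (mem_chart_source _ p))
  rw [← (hsrc x hx).2, c'.left_inv (hsrc x hx).1]

variable (E Q) in
/-- The projection `ρ^m_r : T^m Q → T^r Q`, as a smooth map. -/
def jetProj {m r : ℕ} (h : r ≤ m) :
    C^∞⟮𝓘(ℝ, Fin (m + 1) → E), JetBundle E Q m; 𝓘(ℝ, Fin (r + 1) → E), JetBundle E Q r⟯ :=
  ⟨jetProjFun h, contMDiff_jetProjFun h⟩

end Jets

section Forms
variable {V H : Type*} [NormedAddCommGroup V] [NormedSpace ℝ V] [TopologicalSpace H]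
  (I : ModelWithCorners ℝ V H) {M : Type*} [TopologicalSpace M] [ChartedSpace H M]

/-- (Not necessarily smooth) differential 1-forms on a manifold `M`. -/
abbrev OneForm (M : Type*) [TopologicalSpace M] [ChartedSpace H M] : Type _ :=
  ∀ x : M, TangentSpace I x →L[ℝ] ℝ

variable {I}

/-- The local expression of a 1-form in the preferred chart at `x₀`, i.e. its pullback along the
inverse of the chart. -/
def OneForm.local (α : OneForm I M) (x₀ : M) (y : V) : V →L[ℝ] ℝ :=
  (α ((extChartAt I x₀).symm y)).comp (mfderiv 𝓘(ℝ, V) I (extChartAt I x₀).symm y)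

/-- The exterior derivative of a 1-form on a manifold without boundary, computed at `x` in the
preferred chart at `x` (with respect to which Mathlib identifies `T_x M` with the model space):
`dα(u, v) = (D_u α)(v) - (D_v α)(u)`. -/
def OneForm.extDeriv (α : OneForm I M) (x : M) (u v : TangentSpace I x) : ℝ :=
  fderiv ℝ (α.local x) (extChartAt I x x) u v - fderiv ℝ (α.local x) (extChartAt I x x) v u
end Forms

section Mechanics
variable {E : Type*} [NormedAddCommGroup E] [NormedSpace ℝ E]
variable {Q : Type*} [TopologicalSpace Q] [ChartedSpace E Q] [IsManifold 𝓘(ℝ, E) ∞ Q]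

variable (E) in
/-- The model of `T^m Q`: the vector space `E^{m+1}`. -/
abbrev jetModel (m : ℕ) := 𝓘(ℝ, Fin (m + 1) → E)

/-- The canonical injection `j_{s+1} : T^m Q → T(T^s Q)`, `s < m`, which sends `σ̃^m(0)` to the velocity
at `t = 0` of the canonical lifting `t ↦ σ̃^s(t)`; this is a tangent vector at
`σ̃^s(0) = ρ^m_s(σ̃^m(0))`. -/
def jetVelocity {m s : ℕ} (h : s < m) (p : JetBundle E Q m) :
    TangentSpace (jetModel E s) (jetProj E Q h.le p) :=
  mfderiv 𝓘(ℝ, ℝ) (jetModel E s) (jetLift s p.curve) 0 (1 : ℝ)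

/-- The `r`-th vertical endomorphism `J_r` of `T(T^m Q)`, in natural coordinates at `p`:
`J_r(v_0, …, v_m) = (0, …, 0, r! v_0, ((r+1)!/1!) v_1, …, (m!/(m-r)!) v_{m-r})`. -/
def verticalEndomorphism (m r : ℕ) (p : JetBundle E Q m) :
    TangentSpace (jetModel E m) p →L[ℝ] TangentSpace (jetModel E m) p :=
  (ContinuousLinearMap.pi fun i : Fin (m + 1) =>
    if r ≤ (i : ℕ) then
      (((i : ℕ).factorial : ℝ) / (((i : ℕ) - r).factorial : ℝ)) •
        (ContinuousLinearMap.proj (R := ℝ) (φ := fun _ : Fin (m + 1) => E)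
          ⟨(i : ℕ) - r, by omega⟩)
    else 0 : (Fin (m + 1) → E) →L[ℝ] (Fin (m + 1) → E))

/-- The `r`-th vertical differential of a function, `d_{J_r} f = i(J_r) df = df ∘ J_r`. -/
def verticalDifferential {m : ℕ} (r : ℕ) (f : JetBundle E Q m → ℝ) :
    OneForm (jetModel E m) (JetBundle E Q m) := fun p =>
  (mfderiv (jetModel E m) 𝓘(ℝ, ℝ) f p).comp (verticalEndomorphism m r p)

/-- The linear map `T_p(T^{m+1}Q) → T_{ρ(p)}(T^m Q)`, `(v_0, …, v_{m+1}) ↦ (v_1, …, v_{m+1})` in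
natural coordinates at `p`; its transpose sends `dq_i` to `dq_{i+1}`. -/
def tangentShift {m : ℕ} (p : JetBundle E Q (m + 1)) :
    TangentSpace (jetModel E (m + 1)) p →L[ℝ]
      TangentSpace (jetModel E m) (jetProj E Q m.le_succ p) :=
  (ContinuousLinearMap.pi fun i : Fin (m + 1) =>
    ContinuousLinearMap.proj (R := ℝ) (φ := fun _ : Fin (m + 1 + 1) => E) i.succ :
    (Fin (m + 1 + 1) → E) →L[ℝ] (Fin (m + 1) → E))

/-- Tulczyjew's derivation `d_T` on 1-forms: if `α = ∑ α_i dq_i` in natural coordinates, then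
`d_T α = ∑ ((d_T α_i) dq_i + α_i dq_{i+1})`, where `d_T α_i` at `p` is the derivative of the
coefficient `α_i` along the vector `j_{m+1}(p)`. At each `p` the natural chart centred at `p` is
used. -/
def tulczyjew {m : ℕ} (α : OneForm (jetModel E m) (JetBundle E Q m)) :
    OneForm (jetModel E (m + 1)) (JetBundle E Q (m + 1)) := fun p =>
  (fderiv ℝ (α.local (jetProj E Q m.le_succ p))
      (extChartAt (jetModel E m) (jetProj E Q m.le_succ p) (jetProj E Q m.le_succ p))
      (jetVelocity m.lt_succ_self p)).comp
    (mfderiv (jetModel E (m + 1)) (jetModel E m) (jetProj E Q m.le_succ) p) +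
  (α (jetProj E Q m.le_succ p)).comp (tangentShift p)

/-- The iterates `d_T^j` on 1-forms. -/
def tulczyjewIter {m : ℕ} (α : OneForm (jetModel E m) (JetBundle E Q m)) :
    (j : ℕ) → OneForm (jetModel E (m + j)) (JetBundle E Q (m + j))
  | 0 => α
  | j + 1 => tulczyjew (tulczyjewIter α j)

/-- Pullback of a 1-form along `ρ^m_r`. -/
def OneForm.jetPullback {m r : ℕ} (h : r ≤ m) (α : OneForm (jetModel E r) (JetBundle E Q r)) :
    OneForm (jetModel E m) (JetBundle E Q m) := fun p =>
  (α (jetProj E Q h p)).comp (mfderiv (jetModel E m) (jetModel E r) (jetProj E Q h) p)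

/-- The Lagrangian 1-form `θ_L = ∑_{r=1}^k (-1)^{r-1} (1/r!) d_T^{r-1} d_{J_r} L` on `T^{2k-1} Q`, every
term being pulled back to `T^{2k-1} Q`; the sum is written with `s = r - 1`. -/
def lagrangianForm {k : ℕ} (L : C^∞⟮jetModel E k, JetBundle E Q k; 𝓘(ℝ, ℝ), ℝ⟯) :
    OneForm (jetModel E (2 * k - 1)) (JetBundle E Q (2 * k - 1)) := fun p =>
  ∑ s : Fin k, ((-1) ^ (s : ℕ) / (((s : ℕ) + 1).factorial : ℝ)) •
    (tulczyjewIter (verticalDifferential ((s : ℕ) + 1) L) s).jetPullback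
      (show k + (s : ℕ) ≤ 2 * k - 1 by omega) p

/-- The cotangent space `T_x^* M`. -/
abbrev CotangentSpace {V H M : Type*} [NormedAddCommGroup V] [NormedSpace ℝ V] [TopologicalSpace H]
  (I : ModelWithCorners ℝ V H) [TopologicalSpace M] [ChartedSpace H M] (x : M) :=
  TangentSpace I x →L[ℝ] Trivial M ℝ x

/-- The cotangent bundle `T^* M`, with Mathlib's smooth vector bundle structure. -/
abbrev CotangentBundle {V H : Type*} [NormedAddCommGroup V] [NormedSpace ℝ V] [TopologicalSpace H]
  (I : ModelWithCorners ℝ V H) (M : Type*) [TopologicalSpace M] [ChartedSpace H M] :=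
  TotalSpace (V →L[ℝ] ℝ) (CotangentSpace I : M → Type _)

variable (E Q) in
/-- The pullback to `T^{2k-1} Q` of the vector bundle `T^*(T^{k-1} Q) → T^{k-1} Q` along `ρ^{2k-1}_{k-1}`. -/
abbrev UnifiedFibre {k : ℕ} (hk : 1 ≤ k) : JetBundle E Q (2 * k - 1) → Type _ :=
  (jetProj E Q (show k - 1 ≤ 2 * k - 1 by omega)) *ᵖ
    (CotangentSpace (jetModel E (k - 1)) : JetBundle E Q (k - 1) → Type _)

variable (E Q) in
/-- The unified phase space `W = T^{2k-1} Q ×_{T^{k-1} Q} T^*(T^{k-1} Q)`, as a smooth manifold. -/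
abbrev UnifiedSpace {k : ℕ} (hk : 1 ≤ k) : Type _ :=
  TotalSpace ((Fin (k - 1 + 1) → E) →L[ℝ] ℝ) (UnifiedFibre E Q hk)

variable (E) in
/-- The model of `W`. -/
abbrev unifiedModel (k : ℕ) :=
  (jetModel E (2 * k - 1)).prod 𝓘(ℝ, (Fin (k - 1 + 1) → E) →L[ℝ] ℝ)


section Unified
variable {k : ℕ} (hk : 1 ≤ k)

variable (E Q) in
/-- The momentum phase space `T^*(T^{k-1} Q)`. -/
abbrev MomentumSpace (k : ℕ) : Type _ :=
  CotangentBundle (jetModel E (k - 1)) (JetBundle E Q (k - 1))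

variable (E) in
/-- The model of `T^*(T^{k-1} Q)`. -/
abbrev momentumModel (k : ℕ) :=
  (jetModel E (k - 1)).prod 𝓘(ℝ, (Fin (k - 1 + 1) → E) →L[ℝ] ℝ)

/-- The projection `pr₁ : W → T^{2k-1} Q`. -/
def pr₁ (w : UnifiedSpace E Q hk) : JetBundle E Q (2 * k - 1) := w.proj

/-- The projection `pr₂ : W → T^*(T^{k-1} Q)`. -/
def pr₂ (w : UnifiedSpace E Q hk) : MomentumSpace E Q k :=
  ⟨jetProj E Q (show k - 1 ≤ 2 * k - 1 by omega) w.proj, w.snd⟩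

variable (E Q k) in
/-- The canonical (Liouville) 1-form of `T^*(T^{k-1} Q)`: `θ_a(u) = ⟨a, Tπ(u)⟩`. -/
def liouvilleForm : OneForm (momentumModel E k) (MomentumSpace E Q k) := fun a =>
  ContinuousLinearMap.comp (a.snd : TangentSpace (jetModel E (k - 1)) a.proj →L[ℝ] ℝ)
    (mfderiv (momentumModel E k) (jetModel E (k - 1))
      (TotalSpace.proj : MomentumSpace E Q k → JetBundle E Q (k - 1)) a)

/-- The canonical symplectic form `ω_{k-1} = -dθ_{k-1}` of `T^*(T^{k-1} Q)`. -/
def canonicalTwoForm (a : MomentumSpace E Q k) (u v : TangentSpace (momentumModel E k) a) : ℝ :=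
  -(liouvilleForm E Q k).extDeriv a u v

/-- The presymplectic form `Ω = pr₂^* ω_{k-1}` on `W`. -/
def unifiedTwoForm (w : UnifiedSpace E Q hk) (u v : TangentSpace (unifiedModel E k) w) : ℝ :=
  canonicalTwoForm (pr₂ hk w)
    (mfderiv (unifiedModel E k) (momentumModel E k) (pr₂ hk) w u)
    (mfderiv (unifiedModel E k) (momentumModel E k) (pr₂ hk) w v)

/-- The coupling function `C(p, α) = ⟨α, j_k(p)⟩` on `W`. -/
def coupling (w : UnifiedSpace E Q hk) : ℝ :=
  ((pr₂ hk w).snd : TangentSpace (jetModel E (k - 1)) (pr₂ hk w).proj →L[ℝ] ℝ)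
    (jetVelocity (show k - 1 < 2 * k - 1 by omega) (pr₁ hk w))

/-- The Hamiltonian function `H = C - (ρ^{2k-1}_k ∘ pr₁)^* L` on `W`. -/
def unifiedHamiltonian (L : C^∞⟮jetModel E k, JetBundle E Q k; 𝓘(ℝ, ℝ), ℝ⟯)
    (w : UnifiedSpace E Q hk) : ℝ :=
  coupling hk w - L (jetProj E Q (show k ≤ 2 * k - 1 by omega) (pr₁ hk w))

variable (E Q) in
/-- The elements of `ker Ω`: smooth vector fields `Y` on `W` with `i(Y)Ω = 0`. -/
structure KernelField where
  /-- the vector field -/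
  toFun : ∀ w : UnifiedSpace E Q hk, TangentSpace (unifiedModel E k) w
  smooth : ContMDiff (unifiedModel E k) (unifiedModel E k).tangent ∞
    (fun w => (⟨w, toFun w⟩ : TangentBundle (unifiedModel E k) (UnifiedSpace E Q hk)))
  mem_ker : ∀ w v, unifiedTwoForm hk w (toFun w) v = 0

/-- The set `W_c` of the points of `W` at which `i(Y)dH` vanishes for all `Y ∈ ker Ω`. -/
def compatibilitySet (L : C^∞⟮jetModel E k, JetBundle E Q k; 𝓘(ℝ, ℝ), ℝ⟯) :
    Set (UnifiedSpace E Q hk) :=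
  {w | ∀ Y : KernelField E Q hk,
    mfderiv (unifiedModel E k) 𝓘(ℝ, ℝ) (unifiedHamiltonian hk L) w (Y.toFun w) = 0}

/-- `F : T^{2k-1} Q → T^*(T^{k-1} Q)` is the Legendre-Ostrogradsky map of `L`: for every `p`, `F(p)` is a
covector at `ρ^{2k-1}_{k-1}(p)` with `θ_L(u) = ⟨F(p), Tρ^{2k-1}_{k-1}(u)⟩` for all `u ∈ T_p(T^{2k-1} Q)`. -/
def IsLegendreOstrogradskyMap (L : C^∞⟮jetModel E k, JetBundle E Q k; 𝓘(ℝ, ℝ), ℝ⟯)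
    (F : JetBundle E Q (2 * k - 1) → MomentumSpace E Q k) : Prop :=
  ∀ p : JetBundle E Q (2 * k - 1),
    ∃ a : TangentSpace (jetModel E (k - 1)) (jetProj E Q (show k - 1 ≤ 2 * k - 1 by omega) p) →L[ℝ] ℝ,
      F p = ⟨jetProj E Q (show k - 1 ≤ 2 * k - 1 by omega) p, a⟩ ∧
      ∀ u : TangentSpace (jetModel E (2 * k - 1)) p, lagrangianForm L p u =
        a (mfderiv (jetModel E (2 * k - 1)) (jetModel E (k - 1))
          (jetProj E Q (show k - 1 ≤ 2 * k - 1 by omega)) p u)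

/-- The graph of a map `F : T^{2k-1} Q → T^*(T^{k-1} Q)`, as a subset of `W`. -/
def graphIn (F : JetBundle E Q (2 * k - 1) → MomentumSpace E Q k) : Set (UnifiedSpace E Q hk) :=
  {w | pr₂ hk w = F (pr₁ hk w)}

end Unified
end Mechanics

section Submanifolds
variable {V H : Type*} [NormedAddCommGroup V] [NormedSpace ℝ V] [TopologicalSpace H]
  (I : ModelWithCorners ℝ V H) {M : Type*} [TopologicalSpace M] [ChartedSpace H M]

/-- `S` is an embedded smooth submanifold (of some dimension `d`) of the finite-dimensional manifold
without boundary `M`: near each of its points there is a chart of the maximal smooth atlas in which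
`S` is a `d`-dimensional linear subspace. -/
def IsEmbeddedSubmanifold (S : Set M) : Prop :=
  ∃ d : ℕ, ∀ x ∈ S, ∃ e ∈ IsManifold.maximalAtlas I ∞ M, x ∈ e.source ∧
    ∃ A : Submodule ℝ V, Module.finrank ℝ A = d ∧ ∀ y ∈ e.source, y ∈ S ↔ e.extend I y ∈ A

/-- For an embedded submanifold `T` of `M`: the set `S` is an embedded submanifold of the manifold `T`
(of some dimension `d`). That is, `S ⊆ T`, and near each point of `S` there is a chart of `M` in which
`T` is a linear subspace `B` (such a chart restricts to a chart of `T`) and `S` is a `d`-dimensional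
linear subspace `A` of `B`. In particular `S` is an embedded submanifold of `M`. -/
def IsEmbeddedSubmanifoldOf (S T : Set M) : Prop :=
  S ⊆ T ∧ ∃ d : ℕ, ∀ x ∈ S, ∃ e ∈ IsManifold.maximalAtlas I ∞ M, x ∈ e.source ∧
    ∃ A B : Submodule ℝ V, A ≤ B ∧ Module.finrank ℝ A = d ∧
      (∀ y ∈ e.source, y ∈ S ↔ e.extend I y ∈ A) ∧
      ∀ y ∈ e.source, y ∈ T ↔ e.extend I y ∈ B

end Submanifolds
end SkinnerRusk
end

open SkinnerRusk

/-! In natural coordinates $(q_0,\dots,q_{2k-1};p^0,\dots,p^{k-1})$ on $W$ one has, up to the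
obvious projections, $\Omega=\sum_{i<k}dq_i\wedge dp^i$ and
$H=\sum_{i<k}p^iq_{i+1}-L(q_0,\dots,q_k)$. The radical of $\Omega$ is therefore spanned by the
$\partial/\partial q_i$ with $i\ge k$. Among these only $\partial/\partial q_k$ can act nontrivially
on $H$, giving $p^{k-1}-\partial L/\partial q_k$. Thus $W_c$ is cut out by $p^{k-1}=\partial
L/\partial q_k$ (`mfderiv_unifiedHamiltonian`, `mem_compatibilitySet_iff`). Bump functions extend
each radical vector to a global field in the kernel (`exists_kernelField`), so testing against
fields loses nothing.

The form $\theta_L$ is compared with this through its leading behaviour. On vectors whose components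
of order $<k-1$ vanish, each $d_T^{s}d_{J_{s+1}}L$ is a multiple of $\partial L/\partial q_k$
applied to the component of order $k-1$. The weighted multiples sum to $1$ by a binomial identity
(`hasSymbol_lagrangianForm`). Hence $\theta_L$ is semibasic over $T^{k-1}Q$, so $\mathcal{FL}$
exists. It is unique because $T\rho^{2k-1}_{k-1}$ is surjective. Moreover its top momentum is
$\partial L/\partial q_k$, so $W_c$ is the set where $\alpha-\mathcal{FL}(p)$ kills the top vertical
directions.

The shear $(q,\pi)\mapsto(q,\pi-\mathcal{FL}(q))$ then turns $W_o$ into $\{\pi=0\}$ and $W_c$ into a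
linear condition on $\pi$ in one and the same chart (`exists_adapted_chart`).

Most of the labour is invariance. $J_r$ and $d_T$ are defined at each point in the preferred chart
of that point, whereas smoothness and iteration require formulas in one fixed chart
(`fderiv_jetTransition_coordVertical`, `coordForm_tulczyjew`). -/

namespace SkinnerRusk
noncomputable section

/-! ### Linear algebra of jet coordinates: truncation, shift, vertical endomorphisms. -/

section JetCoordinates
variable {E : Type*} [NormedAddCommGroup E] [NormedSpace ℝ E]

/-- Truncation `(q_0, …, q_m) ↦ (q_0, …, q_r)`. -/
def jetTrunc (E : Type*) [NormedAddCommGroup E] [NormedSpace ℝ E] {m r : ℕ} (h : r ≤ m) :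
    (Fin (m + 1) → E) →L[ℝ] (Fin (r + 1) → E) :=
  ContinuousLinearMap.pi fun i => ContinuousLinearMap.proj (i.castLE (by omega))

/-- The shift `(q_0, …, q_m) ↦ (q_1, …, q_{s+1})`. -/
def jetShift (E : Type*) [NormedAddCommGroup E] [NormedSpace ℝ E] {m s : ℕ} (h : s < m) :
    (Fin (m + 1) → E) →L[ℝ] (Fin (s + 1) → E) :=
  ContinuousLinearMap.pi fun i => ContinuousLinearMap.proj (i.succ.castLE (by omega))

/-- The coordinate expression of the `r`-th vertical endomorphism. -/
def coordVertical (E : Type*) [NormedAddCommGroup E] [NormedSpace ℝ E] (m r : ℕ) :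
    (Fin (m + 1) → E) →L[ℝ] (Fin (m + 1) → E) :=
  ContinuousLinearMap.pi fun i : Fin (m + 1) =>
    if r ≤ (i : ℕ) then
      (((i : ℕ).factorial : ℝ) / (((i : ℕ) - r).factorial : ℝ)) •
        (ContinuousLinearMap.proj (R := ℝ) (φ := fun _ : Fin (m + 1) => E)
          ⟨(i : ℕ) - r, by omega⟩)
    else 0

@[simp] theorem jetTrunc_apply {m r : ℕ} (h : r ≤ m) (q : Fin (m + 1) → E) (i : Fin (r + 1)) :
    jetTrunc E h q i = q (i.castLE (by omega)) := rfl

@[simp] theorem jetShift_apply {m s : ℕ} (h : s < m) (q : Fin (m + 1) → E) (i : Fin (s + 1)) :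
    jetShift E h q i = q (i.succ.castLE (by omega)) := rfl

theorem coordVertical_apply (m r : ℕ) (v : Fin (m + 1) → E) (i : Fin (m + 1)) :
    coordVertical E m r v i = if r ≤ (i : ℕ) then
      (((i : ℕ).factorial : ℝ) / (((i : ℕ) - r).factorial : ℝ)) •
        v ⟨(i : ℕ) - r, by omega⟩ else 0 := by
  simp only [coordVertical, ContinuousLinearMap.pi_apply]
  split_ifs <;> rfl

theorem coordVertical_zero (m : ℕ) : coordVertical E m 0 = ContinuousLinearMap.id ℝ _ := by
  ext v i
  simp [coordVertical_apply, Nat.factorial_ne_zero]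

theorem jetTrunc_coordVertical (m r : ℕ) (v : Fin (m + 1 + 1) → E) :
    jetTrunc E m.le_succ (coordVertical E (m + 1) r v) =
      coordVertical E m r (jetTrunc E m.le_succ v) := by
  ext i
  simp [coordVertical_apply]

/-- The coefficients match because $(i-r)+(r+1)=i+1$, that is,
$\frac{(i+1)!}{(i-r)!}=\frac{i!}{(i-r-1)!}+(r+1)\frac{i!}{(i-r)!}$. This is the commutation rule of
$J_{r+1}$ with the shift that drives the induction on the jet order. -/
theorem jetShift_coordVertical (m r : ℕ) (v : Fin (m + 1 + 1) → E) :
    jetShift E m.lt_succ_self (coordVertical E (m + 1) (r + 1) v) =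
      coordVertical E m (r + 1) (jetShift E m.lt_succ_self v) +
        ((r : ℝ) + 1) • coordVertical E m r (jetTrunc E m.le_succ v) := by
  ext i
  rcases i with ⟨i, hi⟩
  simp only [jetShift_apply, coordVertical_apply, Pi.add_apply, Pi.smul_apply, jetTrunc_apply,
    Fin.castLE_mk, Fin.succ_mk]
  rcases lt_trichotomy i r with h | h | h
  · rw [if_neg (by omega), if_neg (by omega), if_neg (by omega)]; simp
  · subst h
    rw [if_pos (by omega), if_neg (by omega), if_pos (by omega)]
    simp [smul_smul, Nat.factorial_succ]
  · obtain ⟨d, rfl⟩ : ∃ d, i = r + 1 + d := ⟨i - (r + 1), by omega⟩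
    rw [if_pos (by omega), if_pos (by omega), if_pos (by omega)]
    have e1 : r + 1 + d + 1 - (r + 1) = d + 1 := by omega
    have e2 : r + 1 + d - (r + 1) = d := by omega
    have e3 : r + 1 + d - r = d + 1 := by omega
    simp only [e1, e2, e3, smul_smul, ← add_smul]
    congr 1
    have hd : ((d.factorial : ℕ) : ℝ) ≠ 0 := by exact_mod_cast d.factorial_ne_zero
    rw [Nat.factorial_succ (r + 1 + d), Nat.factorial_succ d]
    push_cast
    field_simp
    ring

/-- Reduces an identity in order $m+1$ to its truncation, handled by induction, and its shift,
handled by differentiation. -/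
theorem jet_ext {m : ℕ} {v w : Fin (m + 1 + 1) → E}
    (h₀ : jetTrunc E m.le_succ v = jetTrunc E m.le_succ w)
    (h₁ : jetShift E m.lt_succ_self v = jetShift E m.lt_succ_self w) : v = w := by
  ext i
  refine Fin.cases ?_ (fun j => ?_) i
  · exact congrFun h₀ 0
  · exact congrFun h₁ j

end JetCoordinates

/-! ### Natural charts of $T^mQ$ and their differentials. -/

section JetCharts
variable {E : Type*} [NormedAddCommGroup E] [NormedSpace ℝ E]
variable {Q : Type*} [TopologicalSpace Q] [ChartedSpace E Q] [IsManifold 𝓘(ℝ, E) ∞ Q]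
variable {φ ψ : OpenPartialHomeomorph Q E}

/-- The natural chart of `T^m Q` induced by `φ`, as a homeomorphism between open sets. -/
def jetHomeo (m : ℕ) (φ : OpenPartialHomeomorph Q E) (hφ : φ ∈ atlas E Q) :
    OpenPartialHomeomorph (JetBundle E Q m) (Fin (m + 1) → E) :=
  (jetChartedSpaceCore E Q m).openPartialHomeomorph (jetChart m φ hφ) ⟨φ, hφ, rfl⟩

theorem jetHomeo_mem_atlas (m : ℕ) (hφ : φ ∈ atlas E Q) :
    jetHomeo m φ hφ ∈ atlas (Fin (m + 1) → E) (JetBundle E Q m) := by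
  refine mem_iUnion.2 ⟨jetChart m φ hφ, mem_iUnion.2 ⟨⟨φ, hφ, rfl⟩, rfl⟩⟩

theorem base_jetProj {m r : ℕ} (h : r ≤ m) (p : JetBundle E Q m) :
    (jetProj E Q h p).base = p.base := base_jet r _

theorem isOpen_base_mem {m : ℕ} (hφ : φ ∈ atlas E Q) :
    IsOpen {p : JetBundle E Q m | p.base ∈ φ.source} := (jetHomeo m φ hφ).open_source

theorem isOpen_coord_mem {m : ℕ} (hφ : φ ∈ atlas E Q) :
    IsOpen {q : Fin (m + 1) → E | q 0 ∈ φ.target} := (jetHomeo m φ hφ).open_target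

theorem jetOfCoord_jetCoord {m : ℕ} (hφ : φ ∈ atlas E Q) {p : JetBundle E Q m}
    (hp : p.base ∈ φ.source) : jetOfCoord m φ (jetCoord m φ p) = p :=
  (jetHomeo m φ hφ).left_inv hp

theorem jetCoord_jetOfCoord {m : ℕ} (hφ : φ ∈ atlas E Q) {q : Fin (m + 1) → E}
    (hq : q 0 ∈ φ.target) : jetCoord m φ (jetOfCoord m φ q) = q :=
  (jetHomeo m φ hφ).right_inv hq

theorem base_jetOfCoord_mem {m : ℕ} (hφ : φ ∈ atlas E Q) {q : Fin (m + 1) → E}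
    (hq : q 0 ∈ φ.target) : (jetOfCoord m φ q).base ∈ φ.source :=
  (jetHomeo m φ hφ).map_target hq

theorem jetCoord_mem {m : ℕ} (hφ : φ ∈ atlas E Q) {p : JetBundle E Q m}
    (hp : p.base ∈ φ.source) : jetCoord m φ p 0 ∈ φ.target :=
  (jetHomeo m φ hφ).map_source hp

theorem contMDiffOn_jetCoord (m : ℕ) (hφ : φ ∈ atlas E Q) :
    ContMDiffOn (jetModel E m) (jetModel E m) ∞ (jetCoord m φ)
      {p : JetBundle E Q m | p.base ∈ φ.source} :=
  contMDiffOn_of_mem_maximalAtlas (IsManifold.subset_maximalAtlas (jetHomeo_mem_atlas m hφ))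

theorem contMDiffOn_jetOfCoord (m : ℕ) (hφ : φ ∈ atlas E Q) :
    ContMDiffOn (jetModel E m) (jetModel E m) ∞ (jetOfCoord m φ)
      {q : Fin (m + 1) → E | q 0 ∈ φ.target} :=
  contMDiffOn_symm_of_mem_maximalAtlas (IsManifold.subset_maximalAtlas (jetHomeo_mem_atlas m hφ))

theorem mdifferentiableAt_jetCoord {m : ℕ} (hφ : φ ∈ atlas E Q) {p : JetBundle E Q m}
    (hp : p.base ∈ φ.source) :
    MDifferentiableAt (jetModel E m) (jetModel E m) (jetCoord m φ) p :=
  ((contMDiffOn_jetCoord m hφ).contMDiffAt ((isOpen_base_mem hφ).mem_nhds hp)).mdifferentiableAt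
    (by simp)

theorem mdifferentiableAt_jetOfCoord {m : ℕ} (hφ : φ ∈ atlas E Q) {q : Fin (m + 1) → E}
    (hq : q 0 ∈ φ.target) :
    MDifferentiableAt (jetModel E m) (jetModel E m) (jetOfCoord m φ : _ → JetBundle E Q m) q :=
  ((contMDiffOn_jetOfCoord m hφ).contMDiffAt ((isOpen_coord_mem hφ).mem_nhds hq)).mdifferentiableAt
    (by simp)

/-- The differential of the natural coordinates at `p`. -/
def jetDiff {m : ℕ} (φ : OpenPartialHomeomorph Q E) (p : JetBundle E Q m) :
    TangentSpace (jetModel E m) p →L[ℝ] (Fin (m + 1) → E) :=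
  mfderiv (jetModel E m) (jetModel E m) (jetCoord m φ) p

/-- The differential of the inverse of the natural coordinates, as a map to `T_p(T^m Q)`. -/
def jetDiffInv {m : ℕ} (φ : OpenPartialHomeomorph Q E) (q : Fin (m + 1) → E) :
    (Fin (m + 1) → E) →L[ℝ] TangentSpace (jetModel E m) (jetOfCoord m φ q : JetBundle E Q m) :=
  mfderiv (jetModel E m) (jetModel E m) (jetOfCoord m φ) q

theorem jetDiff_jetDiffInv {m : ℕ} (hφ : φ ∈ atlas E Q) {q : Fin (m + 1) → E}
    (hq : q 0 ∈ φ.target) (v : Fin (m + 1) → E) :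
    jetDiff φ (jetOfCoord m φ q) (jetDiffInv φ q v) = v := by
  have h := (mdifferentiable_of_mem_atlas (I := jetModel E m)
    (jetHomeo_mem_atlas m hφ)).comp_symm_deriv hq
  exact DFunLike.congr_fun h v

theorem jetDiffInv_jetDiff {m : ℕ} (hφ : φ ∈ atlas E Q) {p : JetBundle E Q m}
    (hp : p.base ∈ φ.source) (u : TangentSpace (jetModel E m) p) :
    jetDiffInv φ (jetCoord m φ p) (jetDiff φ p u) = u := by
  have h := (mdifferentiable_of_mem_atlas (I := jetModel E m)
    (jetHomeo_mem_atlas m hφ)).symm_comp_deriv hp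
  exact DFunLike.congr_fun h u

/-- The tangent space at $p$ is identified with the model through the preferred chart at $p$. This
is the bridge from the pointwise definitions to arbitrary natural charts. -/
theorem jetDiff_chartAt {m : ℕ} (p : JetBundle E Q m) (u : TangentSpace (jetModel E m) p) :
    jetDiff (chartAt E p.base) p u = u := by
  have h := mfderiv_extChartAt_self (I := jetModel E m) (x := p)
  exact DFunLike.congr_fun h u

theorem jetCoord_jetProj {m r : ℕ} (h : r ≤ m) (hφ : φ ∈ atlas E Q) {p : JetBundle E Q m}
    (hp : p.base ∈ φ.source) :
    jetCoord r φ (jetProj E Q h p) = jetTrunc E h (jetCoord m φ p) := by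
  ext i
  exact jetCoord_jet hφ hp i

theorem jetDiff_mfderiv_jetProj {m r : ℕ} (h : r ≤ m) (hφ : φ ∈ atlas E Q) {p : JetBundle E Q m}
    (hp : p.base ∈ φ.source) (u : TangentSpace (jetModel E m) p) :
    jetDiff φ (jetProj E Q h p) (mfderiv (jetModel E m) (jetModel E r) (jetProj E Q h) p u) =
      jetTrunc E h (jetDiff φ p u) := by
  have hp' : (jetProj E Q h p).base ∈ φ.source := by rwa [base_jetProj]
  have h1 := (mdifferentiableAt_jetCoord hφ hp').hasMFDerivAt.comp p
    ((jetProj E Q h).contMDiff.mdifferentiableAt (by simp)).hasMFDerivAt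
  have h2 := ((jetTrunc E h).hasMFDerivAt (x := jetCoord m φ p)).comp p
    (mdifferentiableAt_jetCoord hφ hp).hasMFDerivAt
  have h3 : (jetCoord r φ ∘ jetProj E Q h) =ᶠ[𝓝 p] (jetTrunc E h ∘ jetCoord m φ) := by
    filter_upwards [(isOpen_base_mem hφ).mem_nhds hp] with x hx
    exact jetCoord_jetProj h hφ hx
  exact DFunLike.congr_fun (hasMFDerivAt_unique h1 (h2.congr_of_eventuallyEq h3)) u

theorem jetCoord_jetLift {s : ℕ} (hφ : φ ∈ atlas E Q) (σ : Curve E Q) {t : ℝ}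
    (ht : σ t ∈ φ.source) (i : Fin (s + 1)) :
    jetCoord s φ (jetLift s σ t) i = iteratedDeriv i (φ ∘ σ) t := by
  have h0 : (σ.shift t) 0 = σ t := congrArg σ (zero_add t)
  rw [jetLift, jetCoord_jet hφ (h0 ▸ ht)]
  have : (φ ∘ (σ.shift t) : ℝ → E) = fun x => (φ ∘ σ) (x + t) := rfl
  rw [this, iteratedDeriv_comp_add_const]
  simp only [zero_add]

omit [IsManifold 𝓘(ℝ, E) ∞ Q] in
theorem base_jetLift {s : ℕ} (σ : Curve E Q) (t : ℝ) : (jetLift s σ t).base = σ t := by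
  rw [jetLift, base_jet]
  exact congrArg σ (zero_add t)

end JetCharts
end
end SkinnerRusk

namespace SkinnerRusk
noncomputable section

/-! ### The canonical injection, coordinate changes, and invariance of $J_r$. -/

section JetVelocity
variable {E : Type*} [NormedAddCommGroup E] [NormedSpace ℝ E]
variable {Q : Type*} [TopologicalSpace Q] [ChartedSpace E Q] [IsManifold 𝓘(ℝ, E) ∞ Q]
variable {φ ψ : OpenPartialHomeomorph Q E}

theorem hasDerivAt_jetCoord_jetLift {s : ℕ} (hφ : φ ∈ atlas E Q) (σ : Curve E Q) {t : ℝ}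
    (ht : σ t ∈ φ.source) :
    HasDerivAt (fun t => (jetCoord s φ (jetLift s σ t) : Fin (s + 1) → E))
      (fun i : Fin (s + 1) => iteratedDeriv (i + 1) (φ ∘ σ) t) t := by
  rw [hasDerivAt_pi]
  intro i
  have h1 : (fun t => jetCoord s φ (jetLift s σ t) i) =ᶠ[𝓝 t] iteratedDeriv i (φ ∘ σ) := by
    filter_upwards [σ.contMDiff.continuous.continuousAt.eventually (φ.open_source.mem_nhds ht)]
      with x hx
    exact jetCoord_jetLift hφ σ hx i
  refine HasDerivAt.congr_of_eventuallyEq ?_ h1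
  rw [iteratedDeriv_succ]
  refine DifferentiableAt.hasDerivAt ?_
  rw [iteratedDeriv_eq_equiv_comp]
  exact (LinearIsometryEquiv.differentiable _).differentiableAt.comp t
    (((contDiffAt_chart_comp hφ σ ht).iteratedFDeriv_right (m := 1) (i := i)
      (by exact_mod_cast le_top)).differentiableAt (by simp))

theorem mdifferentiableAt_jetLift (s : ℕ) (σ : Curve E Q) (t : ℝ) :
    MDifferentiableAt 𝓘(ℝ, ℝ) (jetModel E s) (jetLift s σ) t := by
  have hφ := chart_mem_atlas E (σ t)
  have ht := mem_chart_source E (σ t)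
  have h1 := (hasDerivAt_jetCoord_jetLift (s := s) hφ σ ht).differentiableAt.mdifferentiableAt
  have h2 : jetCoord s (chartAt E (σ t)) (jetLift s σ t) 0 ∈ (chartAt E (σ t)).target :=
    jetCoord_mem hφ (by rwa [base_jetLift])
  refine ((mdifferentiableAt_jetOfCoord hφ h2).comp t h1).congr_of_eventuallyEq ?_
  filter_upwards [σ.contMDiff.continuous.continuousAt.eventually
    ((chartAt E (σ t)).open_source.mem_nhds ht)] with x hx
  exact (jetOfCoord_jetCoord hφ (by rwa [base_jetLift])).symm

theorem jetDiff_mfderiv_jetLift {s : ℕ} (hφ : φ ∈ atlas E Q) (σ : Curve E Q) {t : ℝ}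
    (ht : σ t ∈ φ.source) :
    jetDiff φ (jetLift s σ t) (mfderiv 𝓘(ℝ, ℝ) (jetModel E s) (jetLift s σ) t (1 : ℝ)) =
      fun i : Fin (s + 1) => iteratedDeriv (i + 1) (φ ∘ σ) t := by
  have h1 := (mdifferentiableAt_jetCoord hφ
    (p := jetLift s σ t) (by rwa [base_jetLift])).hasMFDerivAt.comp t
    (mdifferentiableAt_jetLift s σ t).hasMFDerivAt
  have h2 := (hasDerivAt_jetCoord_jetLift (s := s) hφ σ ht).hasFDerivAt.hasMFDerivAt
  have h3 := DFunLike.congr_fun (hasMFDerivAt_unique h1 h2) (1 : ℝ)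
  exact h3.trans (one_smul ℝ (fun i : Fin (s + 1) => iteratedDeriv (i + 1) (φ ∘ σ) t))

/-- In natural coordinates, `j` is the shift. -/
theorem jetDiff_jetVelocity {m s : ℕ} (h : s < m) (hφ : φ ∈ atlas E Q) {p : JetBundle E Q m}
    (hp : p.base ∈ φ.source) :
    jetDiff φ (jetProj E Q h.le p) (jetVelocity h p) = jetShift E h (jetCoord m φ p) := by
  -- The velocity is taken at `jetLift s p.curve 0`, which equals $\rho(p)$ only propositionally;
  -- generalising the base point makes the substitution possible.
  have key : ∀ x : JetBundle E Q s, jetLift s p.curve 0 = x →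
      jetDiff φ x (mfderiv 𝓘(ℝ, ℝ) (jetModel E s) (jetLift s p.curve) 0 (1 : ℝ) :
        Fin (s + 1) → E) = fun i : Fin (s + 1) => iteratedDeriv (i + 1) (φ ∘ p.curve) 0 := by
    rintro x rfl
    exact jetDiff_mfderiv_jetLift hφ p.curve hp
  exact key _ (jetLift_zero s p.curve)

/-- The coordinate change between natural charts. -/
def jetTransition (m : ℕ) (φ ψ : OpenPartialHomeomorph Q E) (q : Fin (m + 1) → E) :
    Fin (m + 1) → E := jetCoord m ψ (jetOfCoord m φ q)

/-- The set of the `q` whose jet with coordinates `q` under `φ` lies in the domain of `ψ`. -/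
def transitionDomain (m : ℕ) (φ ψ : OpenPartialHomeomorph Q E) : Set (Fin (m + 1) → E) :=
  {q | q 0 ∈ φ.target ∩ φ.symm ⁻¹' ψ.source}

theorem mem_transitionDomain {m : ℕ} (hφ : φ ∈ atlas E Q) (hψ : ψ ∈ atlas E Q)
    {q : Fin (m + 1) → E} : q ∈ transitionDomain m φ ψ ↔
      q 0 ∈ φ.target ∧ (jetOfCoord m φ q).base ∈ ψ.source := by
  have := Set.ext_iff.1 (jetChart_trans_source (m := m) hφ hψ) q
  exact this.symm

theorem jetCoord_mem_transitionDomain {m : ℕ} (hφ : φ ∈ atlas E Q) (hψ : ψ ∈ atlas E Q)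
    {p : JetBundle E Q m} (h₁ : p.base ∈ φ.source) (h₂ : p.base ∈ ψ.source) :
    jetCoord m φ p ∈ transitionDomain m φ ψ := by
  rw [mem_transitionDomain hφ hψ, jetOfCoord_jetCoord hφ h₁]
  exact ⟨jetCoord_mem hφ h₁, h₂⟩

omit [NormedSpace ℝ E] [ChartedSpace E Q] [IsManifold 𝓘(ℝ, E) ∞ Q] in
theorem isOpen_transitionDomain (m : ℕ) (φ ψ : OpenPartialHomeomorph Q E) :
    IsOpen (transitionDomain m φ ψ) :=
  (φ.symm.isOpen_inter_preimage ψ.open_source).preimage (continuous_apply 0)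

omit [ChartedSpace E Q] [IsManifold 𝓘(ℝ, E) ∞ Q] in
theorem jetTrunc_mem_transitionDomain {m r : ℕ} (h : r ≤ m) {q : Fin (m + 1) → E}
    (hq : q ∈ transitionDomain m φ ψ) : jetTrunc E h q ∈ transitionDomain r φ ψ := hq

theorem contDiffOn_jetTransition (m : ℕ) (hφ : φ ∈ atlas E Q) (hψ : ψ ∈ atlas E Q) :
    ContDiffOn ℝ ∞ (jetTransition m φ ψ) (transitionDomain m φ ψ) := by
  have h := contDiffOn_jetChart_trans (m := m) hφ hψ
  rwa [jetChart_trans_source] at h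

theorem contDiffAt_jetTransition {m : ℕ} (hφ : φ ∈ atlas E Q) (hψ : ψ ∈ atlas E Q)
    {q : Fin (m + 1) → E} (hq : q ∈ transitionDomain m φ ψ) :
    ContDiffAt ℝ ∞ (jetTransition m φ ψ) q :=
  (contDiffOn_jetTransition m hφ hψ).contDiffAt ((isOpen_transitionDomain m φ ψ).mem_nhds hq)

theorem differentiableAt_jetTransition {m : ℕ} (hφ : φ ∈ atlas E Q) (hψ : ψ ∈ atlas E Q)
    {q : Fin (m + 1) → E} (hq : q ∈ transitionDomain m φ ψ) :
    DifferentiableAt ℝ (jetTransition m φ ψ) q :=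
  (contDiffAt_jetTransition hφ hψ hq).differentiableAt (by simp)

theorem jetTransition_jetCoord {m : ℕ} (hφ : φ ∈ atlas E Q) {p : JetBundle E Q m}
    (hp : p.base ∈ φ.source) : jetTransition m φ ψ (jetCoord m φ p) = jetCoord m ψ p := by
  rw [jetTransition, jetOfCoord_jetCoord hφ hp]

theorem jetDiff_eq_fderiv_jetTransition {m : ℕ} (hφ : φ ∈ atlas E Q) (hψ : ψ ∈ atlas E Q)
    {p : JetBundle E Q m} (h₁ : p.base ∈ φ.source) (h₂ : p.base ∈ ψ.source)
    (u : TangentSpace (jetModel E m) p) :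
    jetDiff ψ p u = fderiv ℝ (jetTransition m φ ψ) (jetCoord m φ p) (jetDiff φ p u) := by
  have h3 := (differentiableAt_jetTransition hφ hψ
    (jetCoord_mem_transitionDomain hφ hψ h₁ h₂)).hasFDerivAt.hasMFDerivAt.comp p
    (mdifferentiableAt_jetCoord hφ h₁).hasMFDerivAt
  have h4 : jetCoord m ψ =ᶠ[𝓝 p] (jetTransition m φ ψ ∘ jetCoord m φ) := by
    filter_upwards [(isOpen_base_mem hφ).mem_nhds h₁] with x hx
    exact (jetTransition_jetCoord hφ hx).symm
  exact DFunLike.congr_fun (h3.congr_of_eventuallyEq h4).mfderiv u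

theorem jetTrunc_jetTransition {m r : ℕ} (h : r ≤ m) (hφ : φ ∈ atlas E Q) (hψ : ψ ∈ atlas E Q)
    {q : Fin (m + 1) → E} (hq : q ∈ transitionDomain m φ ψ) :
    jetTrunc E h (jetTransition m φ ψ q) = jetTransition r φ ψ (jetTrunc E h q) := by
  obtain ⟨h₁, h₂⟩ := (mem_transitionDomain hφ hψ).1 hq
  have h₃ := base_jetOfCoord_mem hφ h₁
  conv_rhs => rw [← jetCoord_jetOfCoord hφ h₁, ← jetCoord_jetProj h hφ h₃]
  rw [jetTransition_jetCoord hφ (by rwa [base_jetProj]), jetCoord_jetProj h hψ h₂, jetTransition]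

/-- Both sides express the same intrinsic vector, the velocity of the lifted curve, in the
coordinates of $\psi$. It yields $\bar q_{i+1}=d_T\bar q_i$, so no explicit formula for higher
derivatives of a transition map is ever needed. -/
theorem jetShift_jetTransition {m s : ℕ} (h : s < m) (hφ : φ ∈ atlas E Q) (hψ : ψ ∈ atlas E Q)
    {q : Fin (m + 1) → E} (hq : q ∈ transitionDomain m φ ψ) :
    jetShift E h (jetTransition m φ ψ q) =
      fderiv ℝ (jetTransition s φ ψ) (jetTrunc E h.le q) (jetShift E h q) := by
  obtain ⟨h₁, h₂⟩ := (mem_transitionDomain hφ hψ).1 hq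
  have h₃ := base_jetOfCoord_mem hφ h₁
  rw [jetTransition, ← jetDiff_jetVelocity h hψ h₂,
    jetDiff_eq_fderiv_jetTransition (φ := φ) hφ hψ (by rwa [base_jetProj]) (by rwa [base_jetProj]),
    jetDiff_jetVelocity h hφ h₃, jetCoord_jetProj h.le hφ h₃, jetCoord_jetOfCoord hφ h₁]

theorem jetTrunc_fderiv_jetTransition {m r : ℕ} (h : r ≤ m) (hφ : φ ∈ atlas E Q)
    (hψ : ψ ∈ atlas E Q) {q : Fin (m + 1) → E} (hq : q ∈ transitionDomain m φ ψ)
    (v : Fin (m + 1) → E) :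
    jetTrunc E h (fderiv ℝ (jetTransition m φ ψ) q v) =
      fderiv ℝ (jetTransition r φ ψ) (jetTrunc E h q) (jetTrunc E h v) := by
  have h1 := (jetTrunc E h).hasFDerivAt.comp q
    (differentiableAt_jetTransition hφ hψ hq).hasFDerivAt
  have h2 := (differentiableAt_jetTransition hφ hψ
    (jetTrunc_mem_transitionDomain h hq)).hasFDerivAt.comp q (jetTrunc E h).hasFDerivAt
  have h3 : (jetTrunc E h ∘ jetTransition m φ ψ) =ᶠ[𝓝 q]
      (jetTransition r φ ψ ∘ jetTrunc E h) := by
    filter_upwards [(isOpen_transitionDomain m φ ψ).mem_nhds hq] with x hx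
    exact jetTrunc_jetTransition h hφ hψ hx
  exact DFunLike.congr_fun (h1.unique (h2.congr_of_eventuallyEq h3)) v

theorem differentiableAt_fderiv_jetTransition {m : ℕ} (hφ : φ ∈ atlas E Q) (hψ : ψ ∈ atlas E Q)
    {q : Fin (m + 1) → E} (hq : q ∈ transitionDomain m φ ψ) :
    DifferentiableAt ℝ (fderiv ℝ (jetTransition m φ ψ)) q :=
  ((contDiffAt_jetTransition hφ hψ hq).fderiv_right (m := 1) (by norm_cast)).differentiableAt
    (by simp)

/-- The derivative of `jetShift_jetTransition`, by the product rule. -/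
theorem jetShift_fderiv_jetTransition {m s : ℕ} (h : s < m) (hφ : φ ∈ atlas E Q)
    (hψ : ψ ∈ atlas E Q) {q : Fin (m + 1) → E} (hq : q ∈ transitionDomain m φ ψ)
    (v : Fin (m + 1) → E) :
    jetShift E h (fderiv ℝ (jetTransition m φ ψ) q v) =
      fderiv ℝ (fderiv ℝ (jetTransition s φ ψ)) (jetTrunc E h.le q) (jetTrunc E h.le v)
          (jetShift E h q) +
        fderiv ℝ (jetTransition s φ ψ) (jetTrunc E h.le q) (jetShift E h v) := by
  have h1 := (jetShift E h).hasFDerivAt.comp q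
    (differentiableAt_jetTransition hφ hψ hq).hasFDerivAt
  have h2 := ((differentiableAt_fderiv_jetTransition hφ hψ
    (jetTrunc_mem_transitionDomain h.le hq)).hasFDerivAt.comp q
      (jetTrunc E h.le).hasFDerivAt).clm_apply (jetShift E h).hasFDerivAt
  have h3 : (jetShift E h ∘ jetTransition m φ ψ) =ᶠ[𝓝 q]
      fun q => (fderiv ℝ (jetTransition s φ ψ) ∘ jetTrunc E h.le) q (jetShift E h q) := by
    filter_upwards [(isOpen_transitionDomain m φ ψ).mem_nhds hq] with x hx
    exact jetShift_jetTransition h hφ hψ hx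
  refine (DFunLike.congr_fun (h1.unique (h2.congr_of_eventuallyEq h3)) v).trans ?_
  simp [add_comm]

theorem fderiv_fderiv_jetTransition_comm {m : ℕ} (hφ : φ ∈ atlas E Q) (hψ : ψ ∈ atlas E Q)
    {q : Fin (m + 1) → E} (hq : q ∈ transitionDomain m φ ψ) (v w : Fin (m + 1) → E) :
    fderiv ℝ (fderiv ℝ (jetTransition m φ ψ)) q v w =
      fderiv ℝ (fderiv ℝ (jetTransition m φ ψ)) q w v :=
  ((contDiffAt_jetTransition hφ hψ hq).isSymmSndFDerivAt
    (by simpa using (ENat.LEInfty.out : (2 : ℕ∞ω) ≤ ∞))).eq v w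

/-- The vertical endomorphisms commute with the changes of natural coordinates. -/
theorem fderiv_jetTransition_coordVertical (hφ : φ ∈ atlas E Q) (hψ : ψ ∈ atlas E Q) :
    ∀ (m r : ℕ) {q : Fin (m + 1) → E}, q ∈ transitionDomain m φ ψ → ∀ v : Fin (m + 1) → E,
      fderiv ℝ (jetTransition m φ ψ) q (coordVertical E m r v) =
        coordVertical E m r (fderiv ℝ (jetTransition m φ ψ) q v)
  | m, 0, q, _, v => by simp [coordVertical_zero]
  | 0, r + 1, q, _, v => by
    have : ∀ w, coordVertical E 0 (r + 1) w = 0 := by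
      intro w; ext i; rw [coordVertical_apply, if_neg (by omega)]; rfl
    rw [this, this, map_zero]
  | m + 1, r + 1, q, hq, v => by
    have hq' := jetTrunc_mem_transitionDomain m.le_succ hq
    have ih := fun {x} hx w => @fderiv_jetTransition_coordVertical hφ hψ m (r + 1) x hx w
    have ih' := fderiv_jetTransition_coordVertical hφ hψ m r hq'
    -- The induction hypothesis holds on an open set, so it may be differentiated in the base point:
    -- second derivatives of the transition map also commute with $J_{r+1}$ in their last slot.
    have ih2 : ∀ x w, fderiv ℝ (fderiv ℝ (jetTransition m φ ψ)) (jetTrunc E m.le_succ q) x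
        (coordVertical E m (r + 1) w) = coordVertical E m (r + 1)
        (fderiv ℝ (fderiv ℝ (jetTransition m φ ψ)) (jetTrunc E m.le_succ q) x w) := by
      intro x w
      have h0 := (differentiableAt_fderiv_jetTransition hφ hψ hq').hasFDerivAt
      have h1 := h0.clm_apply (hasFDerivAt_const (coordVertical E m (r + 1) w) _)
      have h2 := (coordVertical E m (r + 1)).hasFDerivAt.comp _
        (h0.clm_apply (hasFDerivAt_const w _))
      have h3 : (fun y => fderiv ℝ (jetTransition m φ ψ) y (coordVertical E m (r + 1) w))
          =ᶠ[𝓝 (jetTrunc E m.le_succ q)] (coordVertical E m (r + 1) ∘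
            fun y => fderiv ℝ (jetTransition m φ ψ) y w) := by
        filter_upwards [(isOpen_transitionDomain m φ ψ).mem_nhds hq'] with y hy
        exact ih hy w
      have := DFunLike.congr_fun (h1.unique (h2.congr_of_eventuallyEq h3)) x
      simpa using this
    apply jet_ext
    · rw [jetTrunc_coordVertical, jetTrunc_fderiv_jetTransition _ hφ hψ hq,
        jetTrunc_fderiv_jetTransition _ hφ hψ hq, jetTrunc_coordVertical, ih hq']
    -- Symmetry of the second derivative moves the vertical vector into the slot where `ih2`
    -- applies, and moves it back afterwards. The extra $(r+1)J_r$ term is absorbed by the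
    -- hypothesis for $r$.
    · rw [jetShift_coordVertical, jetShift_fderiv_jetTransition _ hφ hψ hq,
        jetShift_fderiv_jetTransition _ hφ hψ hq, jetTrunc_fderiv_jetTransition _ hφ hψ hq,
        jetShift_coordVertical, jetTrunc_coordVertical,
        fderiv_fderiv_jetTransition_comm hφ hψ hq', ih2,
        fderiv_fderiv_jetTransition_comm hφ hψ hq', map_add, map_add, map_smul, ih hq', ih']
      exact (add_assoc _ _ _).symm

/-- The definition uses the preferred chart at $p$; commutation with the transition to $\varphi$
gives the same formula in every natural chart. -/
theorem jetDiff_verticalEndomorphism {m : ℕ} (r : ℕ) (hφ : φ ∈ atlas E Q) {p : JetBundle E Q m}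
    (hp : p.base ∈ φ.source) (u : TangentSpace (jetModel E m) p) :
    jetDiff φ p (verticalEndomorphism m r p u) = coordVertical E m r (jetDiff φ p u) := by
  have hc := chart_mem_atlas E p.base
  have hs := mem_chart_source E p.base
  rw [jetDiff_eq_fderiv_jetTransition hc hφ hs hp, jetDiff_eq_fderiv_jetTransition hc hφ hs hp,
    jetDiff_chartAt, jetDiff_chartAt]
  exact fderiv_jetTransition_coordVertical hc hφ m r
    (jetCoord_mem_transitionDomain hc hφ hs hp) u

end JetVelocity
end
end SkinnerRusk

namespace SkinnerRusk
noncomputable section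

/-! ### One-forms in coordinates, Tulczyjew's derivation, and leading symbols. -/

section CoordinateForms
variable {E : Type*} [NormedAddCommGroup E] [NormedSpace ℝ E]
variable {Q : Type*} [TopologicalSpace Q] [ChartedSpace E Q] [IsManifold 𝓘(ℝ, E) ∞ Q]
variable {φ ψ : OpenPartialHomeomorph Q E}

/-- The expression of a 1-form on `T^m Q` in the natural coordinates induced by `φ`. -/
def coordForm {m : ℕ} (φ : OpenPartialHomeomorph Q E)
    (α : OneForm (jetModel E m) (JetBundle E Q m)) (q : Fin (m + 1) → E) :
    (Fin (m + 1) → E) →L[ℝ] ℝ := (α (jetOfCoord m φ q)).comp (jetDiffInv φ q)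

theorem local_eq_coordForm {m : ℕ} (α : OneForm (jetModel E m) (JetBundle E Q m))
    (x : JetBundle E Q m) : α.local x = coordForm (chartAt E x.base) α := rfl

theorem coordForm_jetDiff {m : ℕ} (hφ : φ ∈ atlas E Q)
    (α : OneForm (jetModel E m) (JetBundle E Q m)) {p : JetBundle E Q m}
    (hp : p.base ∈ φ.source) (u : TangentSpace (jetModel E m) p) :
    coordForm φ α (jetCoord m φ p) (jetDiff φ p u) = α p u := by
  -- The covector is evaluated at a base point that is only propositionally $p$, hence the
  -- generalisation over the point and the vector.
  have key : ∀ x : JetBundle E Q m, x = p → ∀ w : Fin (m + 1) → E,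
      (w = (u : Fin (m + 1) → E)) → α x w = α p u := by
    rintro x rfl w rfl; rfl
  exact key _ (jetOfCoord_jetCoord hφ hp) _ (jetDiffInv_jetDiff hφ hp u)

theorem coordForm_change {m : ℕ} (hφ : φ ∈ atlas E Q) (hψ : ψ ∈ atlas E Q)
    (α : OneForm (jetModel E m) (JetBundle E Q m)) {q : Fin (m + 1) → E}
    (hq : q ∈ transitionDomain m φ ψ) :
    coordForm φ α q = (coordForm ψ α (jetTransition m φ ψ q)).comp
      (fderiv ℝ (jetTransition m φ ψ) q) := by
  obtain ⟨h₁, h₂⟩ := (mem_transitionDomain hφ hψ).1 hq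
  have h₃ := base_jetOfCoord_mem hφ h₁
  ext v
  have h := coordForm_jetDiff hψ α h₂ (jetDiffInv φ q v)
  rw [jetDiff_eq_fderiv_jetTransition hφ hψ h₃ h₂, jetDiff_jetDiffInv hφ h₁,
    jetCoord_jetOfCoord hφ h₁] at h
  exact h.symm

/-- A 1-form on `T^m Q` whose expressions in all natural coordinates are smooth. -/
def IsSmoothForm {m : ℕ} (α : OneForm (jetModel E m) (JetBundle E Q m)) : Prop :=
  ∀ φ ∈ atlas E Q, ContDiffOn ℝ ∞ (coordForm φ α) {q | q 0 ∈ φ.target}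

theorem IsSmoothForm.differentiableAt {m : ℕ} {α : OneForm (jetModel E m) (JetBundle E Q m)}
    (hα : IsSmoothForm α) (hφ : φ ∈ atlas E Q) {q : Fin (m + 1) → E} (hq : q 0 ∈ φ.target) :
    DifferentiableAt ℝ (coordForm φ α) q :=
  ((hα φ hφ).contDiffAt ((isOpen_coord_mem hφ).mem_nhds hq)).differentiableAt (by simp)

/-- A function on `T^m Q` in natural coordinates. -/
def coordFun {m : ℕ} (φ : OpenPartialHomeomorph Q E) (f : JetBundle E Q m → ℝ)
    (q : Fin (m + 1) → E) : ℝ := f (jetOfCoord m φ q)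

theorem contDiffOn_coordFun {m : ℕ} (hφ : φ ∈ atlas E Q) {f : JetBundle E Q m → ℝ}
    (hf : ContMDiff (jetModel E m) 𝓘(ℝ, ℝ) ∞ f) :
    ContDiffOn ℝ ∞ (coordFun φ f) {q | q 0 ∈ φ.target} := by
  rw [← contMDiffOn_iff_contDiffOn]
  exact hf.comp_contMDiffOn (contMDiffOn_jetOfCoord m hφ)

theorem mfderiv_jetDiffInv {m : ℕ} (hφ : φ ∈ atlas E Q) {f : JetBundle E Q m → ℝ}
    (hf : ContMDiff (jetModel E m) 𝓘(ℝ, ℝ) ∞ f) {q : Fin (m + 1) → E} (hq : q 0 ∈ φ.target)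
    (v : Fin (m + 1) → E) :
    mfderiv (jetModel E m) 𝓘(ℝ, ℝ) f (jetOfCoord m φ q) (jetDiffInv φ q v) =
      fderiv ℝ (coordFun φ f) q v := by
  have h := (hf.mdifferentiableAt (x := jetOfCoord m φ q) (by simp)).hasMFDerivAt.comp q
    (mdifferentiableAt_jetOfCoord hφ hq).hasMFDerivAt
  let D : (Fin (m + 1) → E) →L[ℝ] ℝ :=
    (mfderiv (jetModel E m) 𝓘(ℝ, ℝ) f (jetOfCoord m φ q)).comp (jetDiffInv φ q)
  have h2 : HasFDerivAt (coordFun φ f) D q := h.hasFDerivAt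
  exact (DFunLike.congr_fun h2.fderiv v).symm

theorem coordForm_verticalDifferential {m : ℕ} (r : ℕ) (hφ : φ ∈ atlas E Q)
    {f : JetBundle E Q m → ℝ} (hf : ContMDiff (jetModel E m) 𝓘(ℝ, ℝ) ∞ f)
    {q : Fin (m + 1) → E} (hq : q 0 ∈ φ.target) :
    coordForm φ (verticalDifferential r f) q =
      (fderiv ℝ (coordFun φ f) q).comp (coordVertical E m r) := by
  ext v
  have hb := base_jetOfCoord_mem hφ hq
  have h := jetDiff_verticalEndomorphism r hφ hb (jetDiffInv φ q v)
  rw [jetDiff_jetDiffInv hφ hq] at h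
  rw [ContinuousLinearMap.comp_apply, ← h, ← mfderiv_jetDiffInv hφ hf hq]
  have h' := jetDiffInv_jetDiff hφ hb (verticalEndomorphism m r _ (jetDiffInv φ q v))
  rw [jetCoord_jetOfCoord hφ hq] at h'
  exact congrArg (mfderiv (jetModel E m) 𝓘(ℝ, ℝ) f (jetOfCoord m φ q)) h'.symm

theorem isSmoothForm_verticalDifferential {m : ℕ} (r : ℕ)
    {f : JetBundle E Q m → ℝ} (hf : ContMDiff (jetModel E m) 𝓘(ℝ, ℝ) ∞ f) :
    IsSmoothForm (verticalDifferential r f) := fun φ hφ =>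
  (((contDiffOn_coordFun hφ hf).fderiv_of_isOpen (isOpen_coord_mem hφ) (m := ∞)
    (by simp)).clm_comp contDiffOn_const).congr
      fun _ hq => coordForm_verticalDifferential r hφ hf hq

/-- The coordinate expression of Tulczyjew's derivation. -/
def coordTulczyjew {m : ℕ} (β : (Fin (m + 1) → E) → ((Fin (m + 1) → E) →L[ℝ] ℝ))
    (q : Fin (m + 1 + 1) → E) : (Fin (m + 1 + 1) → E) →L[ℝ] ℝ :=
  (fderiv ℝ β (jetTrunc E m.le_succ q) (jetShift E m.lt_succ_self q)).comp
      (jetTrunc E m.le_succ) +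
    (β (jetTrunc E m.le_succ q)).comp (jetShift E m.lt_succ_self)

/-- Since $\rho$ preserves the base point in $Q$, the preferred charts at $p$ and $\rho(p)$ come
from the same chart of $Q$. Both chart differentials are identities there, so the definition already
is the coordinate formula. -/
theorem tulczyjew_apply {m : ℕ} (α : OneForm (jetModel E m) (JetBundle E Q m))
    (p : JetBundle E Q (m + 1)) (u : TangentSpace (jetModel E (m + 1)) p) :
    tulczyjew α p u = coordTulczyjew (coordForm (chartAt E p.base) α)
      (jetCoord (m + 1) (chartAt E p.base) p) u := by
  set φ := chartAt E p.base with hφ'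
  have hφ : φ ∈ atlas E Q := chart_mem_atlas E p.base
  have hp : p.base ∈ φ.source := mem_chart_source E p.base
  have hb : chartAt E (jetProj E Q m.le_succ p).base = φ := by rw [base_jetProj]
  have hid : ∀ w, jetDiff φ (jetProj E Q m.le_succ p) w = w := by
    rw [← hb]; exact jetDiff_chartAt _
  have hp' : (jetProj E Q m.le_succ p).base ∈ φ.source := by rwa [base_jetProj]
  have h1 : α.local (jetProj E Q m.le_succ p) = coordForm φ α := by
    rw [local_eq_coordForm, hb]
  have h2 : extChartAt (jetModel E m) (jetProj E Q m.le_succ p) (jetProj E Q m.le_succ p) =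
      jetTrunc E m.le_succ (jetCoord (m + 1) φ p) := by
    rw [← jetCoord_jetProj _ hφ hp, ← hb]; rfl
  have h3 := jetDiff_jetVelocity m.lt_succ_self hφ hp
  rw [hid] at h3
  have h4 := jetDiff_mfderiv_jetProj m.le_succ hφ hp u
  rw [hid, jetDiff_chartAt] at h4
  have h5 := coordForm_jetDiff hφ α hp' (tangentShift p u)
  rw [hid, jetCoord_jetProj _ hφ hp] at h5
  unfold tulczyjew coordTulczyjew
  rw [h1, h2, h3]
  exact congrArg₂ (· + ·) (congrArg (fderiv ℝ (coordForm φ α) _ _) h4) h5.symm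

theorem coordTulczyjew_congr {m : ℕ} {β γ : (Fin (m + 1) → E) → ((Fin (m + 1) → E) →L[ℝ] ℝ)}
    {q : Fin (m + 1 + 1) → E} (h : β =ᶠ[𝓝 (jetTrunc E m.le_succ q)] γ) :
    coordTulczyjew β q = coordTulczyjew γ q := by
  rw [coordTulczyjew, coordTulczyjew, h.fderiv_eq, h.self_of_nhds]

theorem fderiv_pullback_apply {V : Type*} [NormedAddCommGroup V] [NormedSpace ℝ V] {g : V → V}
    {β : V → (V →L[ℝ] ℝ)} {x : V} (hg : DifferentiableAt ℝ g x)
    (hg' : DifferentiableAt ℝ (fderiv ℝ g) x) (hβ : DifferentiableAt ℝ β (g x)) (u w : V) :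
    fderiv ℝ (fun x => (β (g x)).comp (fderiv ℝ g x)) x u w =
      fderiv ℝ β (g x) (fderiv ℝ g x u) (fderiv ℝ g x w) +
        β (g x) (fderiv ℝ (fderiv ℝ g) x u w) := by
  have h := (hβ.hasFDerivAt.comp x hg.hasFDerivAt).clm_comp hg'.hasFDerivAt
  refine (DFunLike.congr_fun (DFunLike.congr_fun h.fderiv u) w).trans ?_
  simp [add_comm]

/-- Naturality of $d_T$: differentiating the pullback produces a second derivative of the transition
map, and so does shifting the first derivative of the lifted transition. The two terms agree by
symmetry. -/
theorem coordTulczyjew_jetTransition {m : ℕ} (hφ : φ ∈ atlas E Q) (hψ : ψ ∈ atlas E Q)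
    {β : (Fin (m + 1) → E) → ((Fin (m + 1) → E) →L[ℝ] ℝ)} {q : Fin (m + 1 + 1) → E}
    (hq : q ∈ transitionDomain (m + 1) φ ψ)
    (hβ : DifferentiableAt ℝ β (jetTransition m φ ψ (jetTrunc E m.le_succ q))) :
    coordTulczyjew (fun x => (β (jetTransition m φ ψ x)).comp
      (fderiv ℝ (jetTransition m φ ψ) x)) q =
    (coordTulczyjew β (jetTransition (m + 1) φ ψ q)).comp
      (fderiv ℝ (jetTransition (m + 1) φ ψ) q) := by
  have hq' := jetTrunc_mem_transitionDomain m.le_succ hq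
  ext v
  simp only [coordTulczyjew, add_apply, ContinuousLinearMap.comp_apply,
    jetTrunc_jetTransition _ hφ hψ hq, jetShift_jetTransition _ hφ hψ hq,
    jetTrunc_fderiv_jetTransition _ hφ hψ hq, jetShift_fderiv_jetTransition _ hφ hψ hq, map_add]
  rw [fderiv_fderiv_jetTransition_comm hφ hψ hq', ← add_assoc]
  congr 1
  exact fderiv_pullback_apply (differentiableAt_jetTransition hφ hψ hq')
    (differentiableAt_fderiv_jetTransition hφ hψ hq') hβ _ _

/-- The chart in the definition of $d_T$ moves with the point. Naturality replaces it by a fixed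
$\varphi$, which makes smoothness visible and allows $d_T$ to be iterated. -/
theorem coordForm_tulczyjew {m : ℕ} (hφ : φ ∈ atlas E Q)
    {α : OneForm (jetModel E m) (JetBundle E Q m)} (hα : IsSmoothForm α)
    {q : Fin (m + 1 + 1) → E} (hq : q 0 ∈ φ.target) :
    coordForm φ (tulczyjew α) q = coordTulczyjew (coordForm φ α) q := by
  set p := jetOfCoord (m + 1) φ q with hp
  set ψ := chartAt E p.base with hψ'
  have hψ : ψ ∈ atlas E Q := chart_mem_atlas E p.base
  have hpψ : p.base ∈ ψ.source := mem_chart_source E p.base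
  have hpφ : p.base ∈ φ.source := base_jetOfCoord_mem hφ hq
  have hqd : q ∈ transitionDomain (m + 1) φ ψ := (mem_transitionDomain hφ hψ).2 ⟨hq, hpψ⟩
  have hqd' := jetTrunc_mem_transitionDomain m.le_succ hqd
  have h1 : coordForm φ α =ᶠ[𝓝 (jetTrunc E m.le_succ q)] fun x =>
      (coordForm ψ α (jetTransition m φ ψ x)).comp (fderiv ℝ (jetTransition m φ ψ) x) := by
    filter_upwards [(isOpen_transitionDomain m φ ψ).mem_nhds hqd'] with x hx
    exact coordForm_change hφ hψ α hx
  have hd : DifferentiableAt ℝ (coordForm ψ α)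
      (jetTransition m φ ψ (jetTrunc E m.le_succ q)) := by
    refine hα.differentiableAt hψ (jetCoord_mem hψ ?_)
    exact ((mem_transitionDomain hφ hψ).1 hqd').2
  rw [coordTulczyjew_congr h1, coordTulczyjew_jetTransition hφ hψ hqd hd]
  ext v
  have h2 := tulczyjew_apply α p (jetDiffInv φ q v)
  refine h2.trans ?_
  have h3 := jetDiff_eq_fderiv_jetTransition hφ hψ hpφ hpψ (jetDiffInv φ q v)
  rw [jetDiff_chartAt, jetDiff_jetDiffInv hφ hq, jetCoord_jetOfCoord hφ hq] at h3
  rw [h3]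
  rfl

theorem IsSmoothForm.tulczyjew {m : ℕ} {α : OneForm (jetModel E m) (JetBundle E Q m)}
    (hα : IsSmoothForm α) : IsSmoothForm (tulczyjew α) := by
  intro φ hφ
  refine ContDiffOn.congr ?_ fun q hq => coordForm_tulczyjew hφ hα hq
  have h1 : ContDiffOn ℝ ∞ (fun q : Fin (m + 1 + 1) → E =>
      coordForm φ α (jetTrunc E m.le_succ q)) {q | q 0 ∈ φ.target} :=
    (hα φ hφ).comp (jetTrunc E m.le_succ).contDiff.contDiffOn fun q hq => hq
  have h2 : ContDiffOn ℝ ∞ (fun q : Fin (m + 1 + 1) → E =>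
      fderiv ℝ (coordForm φ α) (jetTrunc E m.le_succ q)) {q | q 0 ∈ φ.target} :=
    ((hα φ hφ).fderiv_of_isOpen (isOpen_coord_mem hφ) (m := ∞) (by simp)).comp
      (jetTrunc E m.le_succ).contDiff.contDiffOn fun q hq => hq
  exact ((h2.clm_apply (jetShift E m.lt_succ_self).contDiff.contDiffOn).clm_comp
    contDiffOn_const).add (h1.clm_comp contDiffOn_const)

theorem IsSmoothForm.tulczyjewIter {m : ℕ} {α : OneForm (jetModel E m) (JetBundle E Q m)}
    (hα : IsSmoothForm α) : ∀ j, IsSmoothForm (tulczyjewIter α j)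
  | 0 => hα
  | j + 1 => (hα.tulczyjewIter j).tulczyjew

theorem coordForm_jetPullback {m r : ℕ} (h : r ≤ m) (hφ : φ ∈ atlas E Q)
    (α : OneForm (jetModel E r) (JetBundle E Q r)) {q : Fin (m + 1) → E} (hq : q 0 ∈ φ.target) :
    coordForm φ (α.jetPullback h) q =
      (coordForm φ α (jetTrunc E h q)).comp (jetTrunc E h) := by
  ext v
  have hp := base_jetOfCoord_mem hφ hq
  have h1 := coordForm_jetDiff hφ α (p := jetProj E Q h (jetOfCoord m φ q))
    (by rwa [base_jetProj]) (mfderiv (jetModel E m) (jetModel E r) (jetProj E Q h)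
      (jetOfCoord m φ q) (jetDiffInv φ q v))
  rw [jetDiff_mfderiv_jetProj h hφ hp, jetDiff_jetDiffInv hφ hq, jetCoord_jetProj h hφ hp,
    jetCoord_jetOfCoord hφ hq] at h1
  exact h1.symm

/-- On tangent vectors whose components of order `< N` vanish, the form `β` is given by
applying `s` to the component of order `N`. -/
def HasSymbol {m : ℕ} (U : Set (Fin (m + 1) → E))
    (β : (Fin (m + 1) → E) → ((Fin (m + 1) → E) →L[ℝ] ℝ)) (N : ℕ)
    (s : (Fin (m + 1) → E) → (E →L[ℝ] ℝ)) : Prop :=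
  ∃ hN : N < m + 1, ∀ q ∈ U, ∀ v : Fin (m + 1) → E, (∀ i : Fin (m + 1), (i : ℕ) < N → v i = 0) →
    β q v = s q (v ⟨N, hN⟩)

/-- Of $d_T\alpha=\sum(d_T\alpha_i)\,dq_i+\alpha_i\,dq_{i+1}$ only the second sum survives: on a
vector starting in order $N+1$ the first involves derivatives of coefficients that vanish
identically. So $d_T$ raises the order by one and leaves the symbol unchanged. -/
theorem HasSymbol.coordTulczyjew {m : ℕ} {U : Set (Fin (m + 1) → E)} (hU : IsOpen U)
    {β : (Fin (m + 1) → E) → ((Fin (m + 1) → E) →L[ℝ] ℝ)} {N : ℕ}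
    {s : (Fin (m + 1) → E) → (E →L[ℝ] ℝ)} (h : HasSymbol U β N s)
    (hβ : DifferentiableOn ℝ β U) :
    HasSymbol (jetTrunc E m.le_succ ⁻¹' U) (coordTulczyjew β) (N + 1)
      (fun q => s (jetTrunc E m.le_succ q)) := by
  obtain ⟨hN, h⟩ := h
  refine ⟨by omega, fun q hq v hv => ?_⟩
  have hd := (hβ _ hq).differentiableAt (hU.mem_nhds hq)
  -- The truncated vector has no components of order $\le N$, so $\beta$ evaluated on it is zero
  -- near the point and its derivative vanishes.
  have h1 : fderiv ℝ β (jetTrunc E m.le_succ q) (jetShift E m.lt_succ_self q)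
      (jetTrunc E m.le_succ v) = 0 := by
    have h2 := hd.hasFDerivAt.clm_apply (hasFDerivAt_const (jetTrunc E m.le_succ v) _)
    have h3 : (fun x => β x (jetTrunc E m.le_succ v)) =ᶠ[𝓝 (jetTrunc E m.le_succ q)]
        fun _ => (0 : ℝ) := by
      filter_upwards [hU.mem_nhds hq] with x hx
      rw [h x hx (jetTrunc E m.le_succ v) fun i hi => hv _ (by simp; omega)]
      have : jetTrunc E m.le_succ v ⟨N, hN⟩ = 0 := hv _ (by simp)
      rw [this, map_zero]
    have h4 := (hasFDerivAt_const (𝕜 := ℝ) (0 : ℝ)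
      (jetTrunc E m.le_succ q)).congr_of_eventuallyEq h3
    have := DFunLike.congr_fun (h2.unique h4) (jetShift E m.lt_succ_self q)
    simpa using this
  change fderiv ℝ β (jetTrunc E m.le_succ q) (jetShift E m.lt_succ_self q)
    (jetTrunc E m.le_succ v) + β (jetTrunc E m.le_succ q) (jetShift E m.lt_succ_self v) = _
  rw [h1, zero_add,
    h _ hq (jetShift E m.lt_succ_self v) fun i hi => hv _ (by simp; omega)]
  rfl

/-- $J_r$ sends the component of order $m-r$ to order $m$ with factor $m!/(m-r)!$. Higher components
are pushed beyond order $m$, and the lower ones are zero. -/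
theorem hasSymbol_verticalDifferential {m r : ℕ} (hr : r ≤ m) (hφ : φ ∈ atlas E Q)
    {f : JetBundle E Q m → ℝ} (hf : ContMDiff (jetModel E m) 𝓘(ℝ, ℝ) ∞ f) :
    HasSymbol {q | q 0 ∈ φ.target} (coordForm φ (verticalDifferential r f)) (m - r)
      (fun q => ((m.factorial : ℝ) / ((m - r).factorial : ℝ)) •
        (fderiv ℝ (coordFun φ f) q).comp
          (ContinuousLinearMap.single ℝ (fun _ : Fin (m + 1) => E) (Fin.last m))) := by
  refine ⟨by omega, fun q hq v hv => ?_⟩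
  rw [coordForm_verticalDifferential r hφ hf hq]
  simp only [smul_apply, ContinuousLinearMap.comp_apply]
  rw [← map_smul, ← map_smul]
  congr 1
  ext i
  rw [coordVertical_apply]
  rcases eq_or_ne i (Fin.last m) with rfl | hi
  · rw [if_pos (by simpa using hr)]
    simp
  · have hi' : (i : ℕ) < m := Fin.val_lt_last hi
    have h0 : ContinuousLinearMap.single ℝ (fun _ : Fin (m + 1) => E) (Fin.last m)
      (((m.factorial : ℝ) / ((m - r).factorial : ℝ)) • v ⟨m - r, by omega⟩) i = 0 := by
      simp [hi]
    rw [h0]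
    split_ifs with hri
    · rw [hv _ (by simp; omega), smul_zero]
    · rfl

theorem hasSymbol_tulczyjewIter {m : ℕ} (hφ : φ ∈ atlas E Q)
    {α : OneForm (jetModel E m) (JetBundle E Q m)} (hα : IsSmoothForm α) {N : ℕ}
    {s : (Fin (m + 1) → E) → (E →L[ℝ] ℝ)}
    (h : HasSymbol {q | q 0 ∈ φ.target} (coordForm φ α) N s) :
    ∀ j, HasSymbol {q | q 0 ∈ φ.target} (coordForm φ (tulczyjewIter α j)) (N + j)
      (fun q => s (jetTrunc E (Nat.le_add_right m j) q))
  | 0 => h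
  | j + 1 => by
    obtain ⟨hN, h'⟩ := (hasSymbol_tulczyjewIter hφ hα h j).coordTulczyjew (isOpen_coord_mem hφ)
      ((hα.tulczyjewIter j φ hφ).differentiableOn (by simp))
    refine ⟨hN, fun q hq v hv => ?_⟩
    exact (DFunLike.congr_fun (coordForm_tulczyjew hφ (hα.tulczyjewIter j) hq) v).trans
      (h' q hq v hv)

end CoordinateForms
end
end SkinnerRusk

namespace SkinnerRusk
noncomputable section

/-! ### The Lagrangian form is semibasic; existence and uniqueness of the Legendre–Ostrogradsky map.
-/

section Legendre
variable {E : Type*} [NormedAddCommGroup E] [NormedSpace ℝ E]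
variable {Q : Type*} [TopologicalSpace Q] [ChartedSpace E Q] [IsManifold 𝓘(ℝ, E) ∞ Q]
variable {φ ψ : OpenPartialHomeomorph Q E}

theorem coordForm_lagrangianForm {k : ℕ} (L : C^∞⟮jetModel E k, JetBundle E Q k; 𝓘(ℝ, ℝ), ℝ⟯)
    (hφ : φ ∈ atlas E Q) {q : Fin (2 * k - 1 + 1) → E} (hq : q 0 ∈ φ.target)
    (v : Fin (2 * k - 1 + 1) → E) :
    coordForm φ (lagrangianForm L) q v =
      ∑ s : Fin k, ((-1) ^ (s : ℕ) / (((s : ℕ) + 1).factorial : ℝ)) *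
        coordForm φ (tulczyjewIter (verticalDifferential ((s : ℕ) + 1) L) s)
          (jetTrunc E (show k + (s : ℕ) ≤ 2 * k - 1 by omega) q)
          (jetTrunc E (show k + (s : ℕ) ≤ 2 * k - 1 by omega) v) := by
  have h : coordForm φ (lagrangianForm L) q v =
      ∑ s : Fin k, ((-1) ^ (s : ℕ) / (((s : ℕ) + 1).factorial : ℝ)) *
        coordForm φ ((tulczyjewIter (verticalDifferential ((s : ℕ) + 1) L) s).jetPullback
          (show k + (s : ℕ) ≤ 2 * k - 1 by omega)) q v := by
    change lagrangianForm L (jetOfCoord _ φ q) (jetDiffInv φ q v) = _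
    rw [lagrangianForm, sum_apply]
    rfl
  rw [h]
  refine Finset.sum_congr rfl fun s _ => ?_
  rw [coordForm_jetPullback _ hφ _ hq]
  rfl

theorem isSmoothForm_lagrangianForm {k : ℕ}
    (L : C^∞⟮jetModel E k, JetBundle E Q k; 𝓘(ℝ, ℝ), ℝ⟯) : IsSmoothForm (lagrangianForm L) := by
  intro φ hφ
  have h : ContDiffOn ℝ ∞ (fun q : Fin (2 * k - 1 + 1) → E =>
      ∑ s : Fin k, ((-1) ^ (s : ℕ) / (((s : ℕ) + 1).factorial : ℝ)) •
        (coordForm φ (tulczyjewIter (verticalDifferential ((s : ℕ) + 1) L) s)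
          (jetTrunc E (show k + (s : ℕ) ≤ 2 * k - 1 by omega) q)).comp
          (jetTrunc E (show k + (s : ℕ) ≤ 2 * k - 1 by omega))) {q | q 0 ∈ φ.target} := by
    refine ContDiffOn.sum fun s _ => ?_
    have hs := ((isSmoothForm_verticalDifferential ((s : ℕ) + 1) L.contMDiff).tulczyjewIter s
      φ hφ).comp (jetTrunc E (show k + (s : ℕ) ≤ 2 * k - 1 by omega)).contDiff.contDiffOn
      (s := {q : Fin (2 * k - 1 + 1) → E | q 0 ∈ φ.target}) fun q hq => hq
    exact (hs.clm_comp contDiffOn_const).const_smul _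
  refine h.congr fun q hq => ?_
  ext v
  rw [coordForm_lagrangianForm L hφ hq, sum_apply]
  rfl

/-- The summand is $(-1)^s\binom{k}{s+1}$, and the alternating sum of the full binomial row is zero.
This is the total coefficient with which $\partial L/\partial q_k$ enters $\theta_L$. -/
theorem sum_alternating_factorial {k : ℕ} (hk : 1 ≤ k) :
    ∑ s : Fin k, ((-1) ^ (s : ℕ) / (((s : ℕ) + 1).factorial : ℝ)) *
      ((k.factorial : ℝ) / ((k - ((s : ℕ) + 1)).factorial : ℝ)) = 1 := by
  have h := Int.alternating_sum_range_choose_of_ne (n := k) (by omega)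
  rw [Finset.sum_range_succ'] at h
  have h' : (∑ s ∈ Finset.range k, (-1 : ℝ) ^ (s + 1) * (k.choose (s + 1) : ℝ)) + 1 = 0 := by
    exact_mod_cast (by simpa using h)
  rw [Fin.sum_univ_eq_sum_range (fun s => ((-1 : ℝ) ^ s / ((s + 1).factorial : ℝ)) *
      ((k.factorial : ℝ) / ((k - (s + 1)).factorial : ℝ))) k]
  have h2 : ∀ s ∈ Finset.range k, ((-1 : ℝ) ^ s / ((s + 1).factorial : ℝ)) *
      ((k.factorial : ℝ) / ((k - (s + 1)).factorial : ℝ)) =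
      -((-1 : ℝ) ^ (s + 1) * (k.choose (s + 1) : ℝ)) := by
    intro s hs
    rw [Nat.cast_choose ℝ (by have := Finset.mem_range.1 hs; omega), pow_succ]
    field_simp
  rw [Finset.sum_congr rfl h2, Finset.sum_neg_distrib]
  linarith

/-- The term with index $s$ starts in order $k-(s+1)$ and is raised $s$ times by $d_T$, so all terms
meet in order $k-1$ with proportional symbols. This gives both the semibasic property and the value
of the top momentum. -/
theorem hasSymbol_lagrangianForm {k : ℕ} (hk : 1 ≤ k)
    (L : C^∞⟮jetModel E k, JetBundle E Q k; 𝓘(ℝ, ℝ), ℝ⟯) (hφ : φ ∈ atlas E Q) :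
    HasSymbol {q | q 0 ∈ φ.target} (coordForm φ (lagrangianForm L)) (k - 1)
      (fun q => (fderiv ℝ (coordFun φ L) (jetTrunc E (show k ≤ 2 * k - 1 by omega) q)).comp
        (ContinuousLinearMap.single ℝ (fun _ : Fin (k + 1) => E) (Fin.last k))) := by
  refine ⟨by omega, fun q hq v hv => ?_⟩
  rw [coordForm_lagrangianForm L hφ hq]
  have key : ∀ s : Fin k, coordForm φ (tulczyjewIter (verticalDifferential ((s : ℕ) + 1) L) s)
        (jetTrunc E (show k + (s : ℕ) ≤ 2 * k - 1 by omega) q)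
        (jetTrunc E (show k + (s : ℕ) ≤ 2 * k - 1 by omega) v) =
      ((k.factorial : ℝ) / ((k - ((s : ℕ) + 1)).factorial : ℝ)) *
        fderiv ℝ (coordFun φ L) (jetTrunc E (show k ≤ 2 * k - 1 by omega) q)
          (ContinuousLinearMap.single ℝ (fun _ : Fin (k + 1) => E) (Fin.last k)
            (v ⟨k - 1, by omega⟩)) := by
    intro s
    obtain ⟨hN, h⟩ := hasSymbol_tulczyjewIter hφ
      (isSmoothForm_verticalDifferential ((s : ℕ) + 1) L.contMDiff)
      (hasSymbol_verticalDifferential (r := (s : ℕ) + 1) (by omega) hφ L.contMDiff) s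
    rw [h (jetTrunc E (show k + (s : ℕ) ≤ 2 * k - 1 by omega) q) hq
      (jetTrunc E (show k + (s : ℕ) ≤ 2 * k - 1 by omega) v) fun i hi => hv _ (by simp; omega)]
    have he : (⟨k - ((s : ℕ) + 1) + s, hN⟩ : Fin (k + s + 1)).castLE (by omega) =
        (⟨k - 1, by omega⟩ : Fin (2 * k - 1 + 1)) := by
      ext; simp; omega
    rw [jetTrunc_apply, he]
    rfl
  simp only [key, ← mul_assoc]
  rw [← Finset.sum_mul, sum_alternating_factorial hk, one_mul]
  rfl

/-- Extension by zero, a section of the truncation. -/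
def jetExtend (E : Type*) [NormedAddCommGroup E] [NormedSpace ℝ E] (m r : ℕ) :
    (Fin (r + 1) → E) →L[ℝ] (Fin (m + 1) → E) :=
  ContinuousLinearMap.pi fun i => if h : (i : ℕ) < r + 1 then
    ContinuousLinearMap.proj (R := ℝ) (φ := fun _ : Fin (r + 1) => E) ⟨i, h⟩ else 0

theorem jetExtend_apply (m r : ℕ) (v : Fin (r + 1) → E) (i : Fin (m + 1)) :
    jetExtend E m r v i = if h : (i : ℕ) < r + 1 then v ⟨i, h⟩ else 0 := by
  simp only [jetExtend, ContinuousLinearMap.pi_apply]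
  split_ifs <;> rfl

theorem jetTrunc_jetExtend {m r : ℕ} (h : r ≤ m) (v : Fin (r + 1) → E) :
    jetTrunc E h (jetExtend E m r v) = v := by
  ext i
  rw [jetTrunc_apply, jetExtend_apply,
    dif_pos (show ((i.castLE _ : Fin (m + 1)) : ℕ) < r + 1 from i.2)]
  rfl

theorem coordForm_lagrangianForm_eq_zero {k : ℕ} (hk : 1 ≤ k)
    (L : C^∞⟮jetModel E k, JetBundle E Q k; 𝓘(ℝ, ℝ), ℝ⟯) (hφ : φ ∈ atlas E Q)
    {q : Fin (2 * k - 1 + 1) → E} (hq : q 0 ∈ φ.target) {v : Fin (2 * k - 1 + 1) → E}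
    (hv : jetTrunc E (show k - 1 ≤ 2 * k - 1 by omega) v = 0) :
    coordForm φ (lagrangianForm L) q v = 0 := by
  obtain ⟨hN, h⟩ := hasSymbol_lagrangianForm hk L hφ
  have hv' : ∀ i : Fin (2 * k - 1 + 1), (i : ℕ) < k - 1 + 1 → v i = 0 :=
    fun i hi => congrFun hv ⟨i, hi⟩
  rw [h q hq v fun i hi => hv' i (by omega), hv' ⟨k - 1, hN⟩ (by simp), map_zero]

theorem coordForm_lagrangianForm_extend {k : ℕ} (hk : 1 ≤ k)
    (L : C^∞⟮jetModel E k, JetBundle E Q k; 𝓘(ℝ, ℝ), ℝ⟯) (hφ : φ ∈ atlas E Q)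
    {q : Fin (2 * k - 1 + 1) → E} (hq : q 0 ∈ φ.target) (v : Fin (2 * k - 1 + 1) → E) :
    coordForm φ (lagrangianForm L) q (jetExtend E (2 * k - 1) (k - 1)
      (jetTrunc E (show k - 1 ≤ 2 * k - 1 by omega) v)) = coordForm φ (lagrangianForm L) q v := by
  rw [← sub_eq_zero, ← map_sub]
  apply coordForm_lagrangianForm_eq_zero hk L hφ hq
  rw [map_sub, jetTrunc_jetExtend, sub_self]

/-- The frame of `T_p(T^m Q)` given by the natural coordinates induced by `φ`. -/
def jetFrame {m : ℕ} (φ : OpenPartialHomeomorph Q E) (p : JetBundle E Q m) :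
    (Fin (m + 1) → E) →L[ℝ] TangentSpace (jetModel E m) p :=
  (jetDiffInv φ (jetCoord m φ p) : (Fin (m + 1) → E) →L[ℝ] (Fin (m + 1) → E))

theorem jetFrame_jetDiff {m : ℕ} (hφ : φ ∈ atlas E Q) {p : JetBundle E Q m}
    (hp : p.base ∈ φ.source) (u : TangentSpace (jetModel E m) p) :
    jetFrame φ p (jetDiff φ p u) = u := jetDiffInv_jetDiff hφ hp u

theorem jetDiff_jetFrame {m : ℕ} (hφ : φ ∈ atlas E Q) {p : JetBundle E Q m}
    (hp : p.base ∈ φ.source) (v : Fin (m + 1) → E) : jetDiff φ p (jetFrame φ p v) = v := by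
  have key : ∀ x : JetBundle E Q m, x = p → ∀ w : Fin (m + 1) → E,
      (jetDiff φ x w : Fin (m + 1) → E) = jetDiff φ p w := by
    rintro x rfl w; rfl
  exact (key _ (jetOfCoord_jetCoord hφ hp) _).symm.trans
    (jetDiff_jetDiffInv hφ (jetCoord_mem hφ hp) v)

theorem jetDiff_injective {m : ℕ} (hφ : φ ∈ atlas E Q) {p : JetBundle E Q m}
    (hp : p.base ∈ φ.source) {u v : TangentSpace (jetModel E m) p}
    (h : jetDiff φ p u = jetDiff φ p v) : u = v := by
  rw [← jetFrame_jetDiff hφ hp u, h, jetFrame_jetDiff hφ hp]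

theorem mfderiv_jetProj_jetFrame {m r : ℕ} (h : r ≤ m) (hφ : φ ∈ atlas E Q) {p : JetBundle E Q m}
    (hp : p.base ∈ φ.source) (v : Fin (m + 1) → E) :
    mfderiv (jetModel E m) (jetModel E r) (jetProj E Q h) p (jetFrame φ p v) =
      jetFrame φ (jetProj E Q h p) (jetTrunc E h v) := by
  have hp' : (jetProj E Q h p).base ∈ φ.source := by rwa [base_jetProj]
  apply jetDiff_injective hφ hp'
  rw [jetDiff_mfderiv_jetProj h hφ hp, jetDiff_jetFrame hφ hp, jetDiff_jetFrame hφ hp']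

theorem lagrangianForm_jetFrame {k : ℕ}
    (L : C^∞⟮jetModel E k, JetBundle E Q k; 𝓘(ℝ, ℝ), ℝ⟯) (hφ : φ ∈ atlas E Q)
    {p : JetBundle E Q (2 * k - 1)} (hp : p.base ∈ φ.source) (v : Fin (2 * k - 1 + 1) → E) :
    lagrangianForm L p (jetFrame φ p v) =
      coordForm φ (lagrangianForm L) (jetCoord _ φ p) v := by
  rw [← coordForm_jetDiff hφ _ hp, jetDiff_jetFrame hφ hp]

/-- The covector at `ρ(p)` induced by the semibasic form `θ_L` at `p`. -/
def legendreCovector {k : ℕ} (L : C^∞⟮jetModel E k, JetBundle E Q k; 𝓘(ℝ, ℝ), ℝ⟯)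
    (p : JetBundle E Q (2 * k - 1)) :
    TangentSpace (jetModel E (k - 1)) (jetProj E Q (show k - 1 ≤ 2 * k - 1 by omega) p) →L[ℝ] ℝ :=
  (lagrangianForm L p).comp ((jetFrame (chartAt E p.base) p).comp
    ((jetExtend E (2 * k - 1) (k - 1)).comp (jetDiff (chartAt E p.base) _)))

/-- The covector is defined by lifting with zeros in the missing components; semibasicity makes the
value independent of that lift. -/
theorem legendreCovector_mfderiv {k : ℕ} (hk : 1 ≤ k)
    (L : C^∞⟮jetModel E k, JetBundle E Q k; 𝓘(ℝ, ℝ), ℝ⟯)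
    (p : JetBundle E Q (2 * k - 1)) (u : TangentSpace (jetModel E (2 * k - 1)) p) :
    legendreCovector L p (mfderiv (jetModel E (2 * k - 1)) (jetModel E (k - 1))
      (jetProj E Q (show k - 1 ≤ 2 * k - 1 by omega)) p u) = lagrangianForm L p u := by
  have hφ := chart_mem_atlas E p.base
  have hp := mem_chart_source E p.base
  simp only [legendreCovector, ContinuousLinearMap.comp_apply]
  rw [jetDiff_mfderiv_jetProj _ hφ hp, lagrangianForm_jetFrame L hφ hp,
    coordForm_lagrangianForm_extend hk L hφ (jetCoord_mem hφ hp), coordForm_jetDiff hφ _ hp]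

/-- Frees the covector from the preferred chart at $p$: a formula in a fixed $\varphi$ is what
smoothness and the shear chart require. -/
theorem legendreCovector_jetFrame {k : ℕ} (hk : 1 ≤ k)
    (L : C^∞⟮jetModel E k, JetBundle E Q k; 𝓘(ℝ, ℝ), ℝ⟯) (hφ : φ ∈ atlas E Q)
    {p : JetBundle E Q (2 * k - 1)} (hp : p.base ∈ φ.source) (v : Fin (k - 1 + 1) → E) :
    legendreCovector L p (jetFrame φ _ v) =
      coordForm φ (lagrangianForm L) (jetCoord _ φ p) (jetExtend E (2 * k - 1) (k - 1) v) := by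
  rw [← lagrangianForm_jetFrame L hφ hp, ← legendreCovector_mfderiv hk,
    mfderiv_jetProj_jetFrame _ hφ hp, jetTrunc_jetExtend]

/-- The Legendre-Ostrogradsky map. -/
def legendreMap {k : ℕ} (L : C^∞⟮jetModel E k, JetBundle E Q k; 𝓘(ℝ, ℝ), ℝ⟯)
    (p : JetBundle E Q (2 * k - 1)) : MomentumSpace E Q k :=
  ⟨jetProj E Q (show k - 1 ≤ 2 * k - 1 by omega) p, legendreCovector L p⟩

theorem isLegendreOstrogradskyMap_legendreMap {k : ℕ} (hk : 1 ≤ k)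
    (L : C^∞⟮jetModel E k, JetBundle E Q k; 𝓘(ℝ, ℝ), ℝ⟯) :
    IsLegendreOstrogradskyMap hk L (legendreMap L) := fun p =>
  ⟨legendreCovector L p, rfl, fun u => (legendreCovector_mfderiv hk L p u).symm⟩

theorem IsLegendreOstrogradskyMap.eq_legendreMap {k : ℕ} {hk : 1 ≤ k}
    {L : C^∞⟮jetModel E k, JetBundle E Q k; 𝓘(ℝ, ℝ), ℝ⟯}
    {F : JetBundle E Q (2 * k - 1) → MomentumSpace E Q k}
    (hF : IsLegendreOstrogradskyMap hk L F) : F = legendreMap L := by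
  funext p
  obtain ⟨a, ha, h⟩ := hF p
  rw [ha, legendreMap]
  congr 1
  ext w
  have hφ := chart_mem_atlas E p.base
  have hp := mem_chart_source E p.base
  have hp' : (jetProj E Q (show k - 1 ≤ 2 * k - 1 by omega) p).base ∈ (chartAt E p.base).source :=
    by rwa [base_jetProj]
  -- Surjectivity of $T\rho$, by extending the coordinates of $w$ with zeros; the defining equation
  -- then determines the covector.
  obtain ⟨u, rfl⟩ : ∃ u, mfderiv (jetModel E (2 * k - 1)) (jetModel E (k - 1))
      (jetProj E Q (show k - 1 ≤ 2 * k - 1 by omega)) p u = w := by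
    refine ⟨jetFrame (chartAt E p.base) p (jetExtend E _ _ (jetDiff (chartAt E p.base) _ w)), ?_⟩
    rw [mfderiv_jetProj_jetFrame _ hφ hp, jetTrunc_jetExtend, jetFrame_jetDiff hφ hp']
  exact (h u).symm.trans (legendreCovector_mfderiv hk L p u).symm

end Legendre

/-! ### Momentum coordinates and smoothness of the Legendre–Ostrogradsky map. -/

section Cotangent
variable {E : Type*} [NormedAddCommGroup E] [NormedSpace ℝ E]
variable {Q : Type*} [TopologicalSpace Q] [ChartedSpace E Q] [IsManifold 𝓘(ℝ, E) ∞ Q]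
variable {φ ψ : OpenPartialHomeomorph Q E}

/-- The trivializations of `T^*(T^m Q)` are given by the natural momentum coordinates. -/
theorem inCoordinates_cotangent {m : ℕ} {x₀ x : JetBundle E Q m}
    (hx : x.base ∈ (chartAt E x₀.base).source)
    (a : TangentSpace (jetModel E m) x →L[ℝ] Trivial (JetBundle E Q m) ℝ x) :
    ContinuousLinearMap.inCoordinates (Fin (m + 1) → E) (TangentSpace (jetModel E m)) ℝ
      (Trivial (JetBundle E Q m) ℝ) x₀ x x₀ x a =
      ContinuousLinearMap.comp (a : TangentSpace (jetModel E m) x →L[ℝ] ℝ)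
        (jetFrame (chartAt E x₀.base) x) := by
  have h := TangentBundle.symmL_trivializationAt (I := jetModel E m) (x₀ := x₀) (x := x) hx
  rw [ContinuousLinearMap.inCoordinates, h]
  rw [modelWithCornersSelf_coe, range_id, mfderivWithin_univ]
  ext v
  exact DFunLike.congr_fun (Trivial.continuousLinearMapAt_trivialization ℝ (JetBundle E Q m) ℝ x)
    (a (jetFrame (chartAt E x₀.base) x v))

theorem contMDiff_legendreMap {k : ℕ} (hk : 1 ≤ k)
    (L : C^∞⟮jetModel E k, JetBundle E Q k; 𝓘(ℝ, ℝ), ℝ⟯) :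
    ContMDiff (jetModel E (2 * k - 1)) (momentumModel E k) ∞ (legendreMap L) := by
  intro p₀
  set φ := chartAt E p₀.base with hφ'
  have hφ : φ ∈ atlas E Q := chart_mem_atlas E _
  have hp₀ : p₀.base ∈ φ.source := mem_chart_source E p₀.base
  -- Smoothness splits into that of the base map $\rho$ and that of the momenta in the
  -- trivialization at $p_0$. The latter are the coefficients of $\theta_L$ in the chart $\varphi$.
  rw [contMDiffAt_hom_bundle]
  refine ⟨(jetProj E Q _).contMDiff p₀, ?_⟩
  have h1 : ContMDiffAt (jetModel E (2 * k - 1)) 𝓘(ℝ, (Fin (k - 1 + 1) → E) →L[ℝ] ℝ) ∞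
      (fun p => (coordForm φ (lagrangianForm L) (jetCoord _ φ p)).comp
        (jetExtend E (2 * k - 1) (k - 1))) p₀ := by
    have h2 : ContDiffOn ℝ ∞ (fun q => (coordForm φ (lagrangianForm L) q).comp
        (jetExtend E (2 * k - 1) (k - 1))) {q | q 0 ∈ φ.target} :=
      (isSmoothForm_lagrangianForm L φ hφ).clm_comp contDiffOn_const
    have h3 := h2.contDiffAt ((isOpen_coord_mem hφ).mem_nhds (jetCoord_mem hφ hp₀))
    exact h3.contMDiffAt.comp p₀
      ((contMDiffOn_jetCoord _ hφ).contMDiffAt ((isOpen_base_mem hφ).mem_nhds hp₀))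
  refine h1.congr_of_eventuallyEq ?_
  filter_upwards [(isOpen_base_mem hφ).mem_nhds hp₀] with p hp
  have hb : chartAt E (legendreMap L p₀).proj.base = φ := by
    change chartAt E (jetProj E Q _ p₀).base = φ
    rw [base_jetProj]
  have hpb : (legendreMap L p).proj.base ∈ (chartAt E (legendreMap L p₀).proj.base).source := by
    rw [hb]
    change (jetProj E Q _ p).base ∈ _
    rwa [base_jetProj]
  refine (inCoordinates_cotangent hpb _).trans ?_
  rw [hb]
  ext v
  exact legendreCovector_jetFrame hk L hφ hp v

end Cotangent
end
end SkinnerRusk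

namespace SkinnerRusk
noncomputable section

/-! ### Differentials read in preferred charts. -/

section ChartDerivative
variable {V H : Type*} [NormedAddCommGroup V] [NormedSpace ℝ V] [TopologicalSpace H]
  {I : ModelWithCorners ℝ V H} {M : Type*} [TopologicalSpace M] [ChartedSpace H M]
  {V' H' : Type*} [NormedAddCommGroup V'] [NormedSpace ℝ V'] [TopologicalSpace H']
  {I' : ModelWithCorners ℝ V' H'} {M' : Type*} [TopologicalSpace M'] [ChartedSpace H' M']

/-- The differential of a map can be computed from an expression in the preferred charts. -/
theorem hasMFDerivAt_of_chart_eq {f : M → M'} {x : M} {g : V → V'} {g' : V →L[ℝ] V'}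
    (h : ∀ᶠ y in 𝓝 x, f y ∈ (extChartAt I' (f x)).source ∧
      extChartAt I' (f x) (f y) = g (extChartAt I x y))
    (hg : HasFDerivAt g g' (extChartAt I x x)) : HasMFDerivAt I I' f x g' := by
  have hx := h.self_of_nhds
  refine ⟨?_, ?_⟩
  · have h1 : f =ᶠ[𝓝 x] fun y => (extChartAt I' (f x)).symm (g (extChartAt I x y)) := by
      filter_upwards [h] with y hy
      rw [← hy.2, (extChartAt I' (f x)).left_inv hy.1]
    refine ContinuousAt.congr ?_ h1.symm
    have h2 : ContinuousAt (extChartAt I' (f x)).symm (g (extChartAt I x x)) := by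
      rw [← hx.2]; exact continuousAt_extChartAt_symm (f x)
    exact ContinuousAt.comp (f := fun y => g (extChartAt I x y)) h2
      (ContinuousAt.comp hg.continuousAt (continuousAt_extChartAt x))
  · refine hg.hasFDerivWithinAt.congr_of_eventuallyEq ?_ ?_
    · have h3 : Filter.Tendsto (extChartAt I x).symm (𝓝[range I] (extChartAt I x x)) (𝓝 x) := by
        have := (continuousAt_extChartAt_symm (I := I) x).tendsto
        rw [extChartAt_to_inv] at this
        exact this.mono_left nhdsWithin_le_nhds
      filter_upwards [h3.eventually h, extChartAt_target_mem_nhdsWithin (I := I) x] with y hy hy'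
      rw [writtenInExtChartAt, Function.comp_apply, Function.comp_apply, hy.2,
        (extChartAt I x).right_inv hy']
    · rw [writtenInExtChartAt, Function.comp_apply, Function.comp_apply, extChartAt_to_inv, hx.2]

end ChartDerivative

/-! ### The Liouville and canonical symplectic forms in coordinates. -/

section Momentum
variable {E : Type*} [NormedAddCommGroup E] [NormedSpace ℝ E]
variable {Q : Type*} [TopologicalSpace Q] [ChartedSpace E Q] [IsManifold 𝓘(ℝ, E) ∞ Q]
variable {φ : OpenPartialHomeomorph Q E} {k : ℕ}

theorem mem_chartAt_momentum_source {a₀ a : MomentumSpace E Q k} :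
    a ∈ (chartAt (ModelProd (Fin (k - 1 + 1) → E) ((Fin (k - 1 + 1) → E) →L[ℝ] ℝ)) a₀).source ↔
      a.proj.base ∈ (chartAt E a₀.proj.base).source := by
  rw [FiberBundle.chartedSpace_chartAt]
  simp only [mfld_simps]
  exact ⟨fun h => h.2, fun h => ⟨⟨h, trivial⟩, h⟩⟩

theorem chartAt_momentum {a₀ a : MomentumSpace E Q k}
    (ha : a.proj.base ∈ (chartAt E a₀.proj.base).source) :
    chartAt (ModelProd (Fin (k - 1 + 1) → E) ((Fin (k - 1 + 1) → E) →L[ℝ] ℝ)) a₀ a =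
      (jetCoord (k - 1) (chartAt E a₀.proj.base) a.proj,
        ContinuousLinearMap.comp (a.snd : TangentSpace (jetModel E (k - 1)) a.proj →L[ℝ] ℝ)
          (jetFrame (chartAt E a₀.proj.base) a.proj)) := by
  rw [hom_chart, inCoordinates_cotangent ha]
  rfl

/-- In the preferred charts, the Liouville form is `∑ p_i dq_i`. -/
theorem liouvilleForm_local (a : MomentumSpace E Q k)
    {y : (Fin (k - 1 + 1) → E) × ((Fin (k - 1 + 1) → E) →L[ℝ] ℝ)}
    (hy : y.1 0 ∈ (chartAt E a.proj.base).target) :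
    (liouvilleForm E Q k).local a y = y.2.comp (ContinuousLinearMap.fst ℝ _ _) := by
  have hφ := chart_mem_atlas E a.proj.base
  set φ := chartAt E a.proj.base with hφ'
  set c := chartAt (ModelProd (Fin (k - 1 + 1) → E) ((Fin (k - 1 + 1) → E) →L[ℝ] ℝ)) a with hc
  -- The inverse chart is identified by exhibiting the covector with coordinates $z$ and checking
  -- that the chart maps it to $z$.
  have htarget : ∀ z : (Fin (k - 1 + 1) → E) × ((Fin (k - 1 + 1) → E) →L[ℝ] ℝ),
      z.1 0 ∈ φ.target → z ∈ c.target ∧ c.symm z = (⟨jetOfCoord (k - 1) φ z.1,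
        z.2.comp (jetDiff φ (jetOfCoord (k - 1) φ z.1))⟩ : MomentumSpace E Q k) := by
    intro z hz
    set b : MomentumSpace E Q k := ⟨jetOfCoord (k - 1) φ z.1,
        z.2.comp (jetDiff φ (jetOfCoord (k - 1) φ z.1))⟩ with hb
    have hbs : b.proj.base ∈ φ.source := base_jetOfCoord_mem hφ hz
    have hbc : b ∈ c.source := mem_chartAt_momentum_source.2 hbs
    have hcb : c b = z := by
      refine (chartAt_momentum hbs).trans (Prod.ext (jetCoord_jetOfCoord hφ hz) ?_)
      ext v
      exact congrArg z.2 (jetDiff_jetFrame hφ hbs v)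
    rw [← hcb]
    exact ⟨c.map_source hbc, c.left_inv hbc⟩
  have hmd : MDifferentiableAt 𝓘(ℝ, (Fin (k - 1 + 1) → E) × ((Fin (k - 1 + 1) → E) →L[ℝ] ℝ))
      (momentumModel E k) (extChartAt (momentumModel E k) a).symm y := by
    have h1 : y ∈ (extChartAt (momentumModel E k) a).target := by
      rw [extChartAt_target]
      exact ⟨(htarget y hy).1, mem_range_self _⟩
    have h2 := mdifferentiableWithinAt_extChartAt_symm h1
    rwa [ModelWithCorners.range_eq_univ, mdifferentiableWithinAt_univ] at h2
  have hproj := (Bundle.contMDiff_proj (n := ∞) (IB := jetModel E (k - 1))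
    (F := (Fin (k - 1 + 1) → E) →L[ℝ] ℝ) (CotangentSpace (jetModel E (k - 1)) :
      JetBundle E Q (k - 1) → Type _)).mdifferentiableAt
      (x := (extChartAt (momentumModel E k) a).symm y) (by simp)
  have h3 := hproj.hasMFDerivAt.comp y hmd.hasMFDerivAt
  have h4 : (TotalSpace.proj ∘ (extChartAt (momentumModel E k) a).symm) =ᶠ[𝓝 y]
      (jetOfCoord (k - 1) φ ∘ Prod.fst) := by
    have : {z : (Fin (k - 1 + 1) → E) × ((Fin (k - 1 + 1) → E) →L[ℝ] ℝ) |
        z.1 0 ∈ φ.target} ∈ 𝓝 y :=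
      ((isOpen_coord_mem hφ).preimage continuous_fst).mem_nhds hy
    filter_upwards [this] with z hz
    exact congrArg TotalSpace.proj (htarget z hz).2
  have h5 := (mdifferentiableAt_jetOfCoord (m := k - 1) hφ hy).hasMFDerivAt.comp y
    (ContinuousLinearMap.fst ℝ (Fin (k - 1 + 1) → E)
      ((Fin (k - 1 + 1) → E) →L[ℝ] ℝ)).hasMFDerivAt
  -- The bundle projection after the inverse chart is `jetOfCoord` after the first projection, so
  -- their differentials agree. The frame in the momenta then cancels the differential of
  -- `jetOfCoord`.
  have h6 := hasMFDerivAt_unique h3 (h5.congr_of_eventuallyEq h4)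
  refine ContinuousLinearMap.ext fun u => ?_
  have h7 := DFunLike.congr_fun h6 u
  have key : ∀ b : MomentumSpace E Q k, b = ⟨jetOfCoord (k - 1) φ y.1,
      y.2.comp (jetDiff φ (jetOfCoord (k - 1) φ y.1))⟩ → ∀ w : Fin (k - 1 + 1) → E,
      (b.snd : TangentSpace (jetModel E (k - 1)) b.proj →L[ℝ] ℝ) w =
        y.2 (jetDiff φ (jetOfCoord (k - 1) φ y.1) w) := by
    rintro b rfl w; rfl
  refine (key _ (htarget y hy).2 _).trans ?_
  refine congrArg y.2 ?_
  refine (congrArg (jetDiff φ (jetOfCoord (k - 1) φ y.1)) h7).trans ?_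
  exact jetDiff_jetDiffInv hφ hy u.1

theorem fderiv_eq_of_eventuallyEq_comp_fst {A : Type*} [NormedAddCommGroup A] [NormedSpace ℝ A]
    {f : A × (A →L[ℝ] ℝ) → (A × (A →L[ℝ] ℝ)) →L[ℝ] ℝ} {x : A × (A →L[ℝ] ℝ)}
    (h : f =ᶠ[𝓝 x] fun y => y.2.comp (ContinuousLinearMap.fst ℝ _ _)) (u v : A × (A →L[ℝ] ℝ)) :
    fderiv ℝ f x u v = u.2 v.1 := by
  have h1 := ((ContinuousLinearMap.snd ℝ A (A →L[ℝ] ℝ)).hasFDerivAt (x := x)).clm_comp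
    (hasFDerivAt_const (ContinuousLinearMap.fst ℝ A (A →L[ℝ] ℝ)) x)
  rw [h.fderiv_eq]
  refine (DFunLike.congr_fun (DFunLike.congr_fun h1.fderiv u) v).trans ?_
  simp

/-- Near $a$ the Liouville form has the expression $p\,dq$, linear in $p$ and independent of $q$, so
$-d\theta=dq\wedge dp$ with constant coefficients. -/
theorem canonicalTwoForm_apply (a : MomentumSpace E Q k)
    (u v : (Fin (k - 1 + 1) → E) × ((Fin (k - 1 + 1) → E) →L[ℝ] ℝ)) :
    canonicalTwoForm a u v = v.2 u.1 - u.2 v.1 := by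
  have h : (liouvilleForm E Q k).local a =ᶠ[𝓝 (extChartAt (momentumModel E k) a a)]
      fun y => y.2.comp (ContinuousLinearMap.fst ℝ _ _) := by
    have : {z : (Fin (k - 1 + 1) → E) × ((Fin (k - 1 + 1) → E) →L[ℝ] ℝ) |
        z.1 0 ∈ (chartAt E a.proj.base).target} ∈ 𝓝 (extChartAt (momentumModel E k) a a) := by
      refine ((isOpen_coord_mem (m := k - 1) (chart_mem_atlas E _)).preimage
        continuous_fst).mem_nhds ?_
      exact jetCoord_mem (chart_mem_atlas E _) (mem_chart_source E a.proj.base)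
    filter_upwards [this] with z hz
    exact liouvilleForm_local a hz
  have h' := fderiv_eq_of_eventuallyEq_comp_fst h
  refine (congrArg Neg.neg (congrArg₂ (· - ·) (h' u v) (h' v u))).trans ?_
  simp

end Momentum
end
end SkinnerRusk

namespace SkinnerRusk
noncomputable section

/-! ### The Hamiltonian in coordinates and the top momentum of the Legendre covector. -/

section UnifiedCoordinates
variable {E : Type*} [NormedAddCommGroup E] [NormedSpace ℝ E]
variable {Q : Type*} [TopologicalSpace Q] [ChartedSpace E Q] [IsManifold 𝓘(ℝ, E) ∞ Q]
variable {φ : OpenPartialHomeomorph Q E}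

/-- The map `pr₂` in coordinates. -/
def coordPr₂ (E : Type*) [NormedAddCommGroup E] [NormedSpace ℝ E] (k : ℕ) :
    ((Fin (2 * k - 1 + 1) → E) × ((Fin (k - 1 + 1) → E) →L[ℝ] ℝ)) →L[ℝ]
      ((Fin (k - 1 + 1) → E) × ((Fin (k - 1 + 1) → E) →L[ℝ] ℝ)) :=
  (jetTrunc E (show k - 1 ≤ 2 * k - 1 by omega)).prodMap (ContinuousLinearMap.id ℝ _)

/-- The Hamiltonian in coordinates. -/
def coordHamiltonian {k : ℕ} (hk : 1 ≤ k) (L : C^∞⟮jetModel E k, JetBundle E Q k; 𝓘(ℝ, ℝ), ℝ⟯)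
    (φ : OpenPartialHomeomorph Q E)
    (y : (Fin (2 * k - 1 + 1) → E) × ((Fin (k - 1 + 1) → E) →L[ℝ] ℝ)) : ℝ :=
  y.2 (jetShift E (show k - 1 < 2 * k - 1 by omega) y.1) -
    coordFun φ L (jetTrunc E (show k ≤ 2 * k - 1 by omega) y.1)

theorem hasFDerivAt_coordHamiltonian {k : ℕ} (hk : 1 ≤ k)
    (L : C^∞⟮jetModel E k, JetBundle E Q k; 𝓘(ℝ, ℝ), ℝ⟯)
    (hφ : φ ∈ atlas E Q) {y : (Fin (2 * k - 1 + 1) → E) × ((Fin (k - 1 + 1) → E) →L[ℝ] ℝ)}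
    (hy : y.1 0 ∈ φ.target) :
    ∃ D : ((Fin (2 * k - 1 + 1) → E) × ((Fin (k - 1 + 1) → E) →L[ℝ] ℝ)) →L[ℝ] ℝ,
      HasFDerivAt (coordHamiltonian hk L φ) D y ∧
      ∀ v, D (v, 0) = y.2 (jetShift E (show k - 1 < 2 * k - 1 by omega) v) -
        fderiv ℝ (coordFun φ L) (jetTrunc E (show k ≤ 2 * k - 1 by omega) y.1)
          (jetTrunc E (show k ≤ 2 * k - 1 by omega) v) := by
  have h1 := (hasFDerivAt_snd (𝕜 := ℝ) (E := Fin (2 * k - 1 + 1) → E)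
    (F := (Fin (k - 1 + 1) → E) →L[ℝ] ℝ) (p := y)).clm_apply
    ((jetShift E (show k - 1 < 2 * k - 1 by omega)).hasFDerivAt.comp y
      (hasFDerivAt_fst (𝕜 := ℝ)))
  have h2 : DifferentiableAt ℝ (coordFun φ L)
      (jetTrunc E (show k ≤ 2 * k - 1 by omega) y.1) :=
    ((contDiffOn_coordFun hφ L.contMDiff).contDiffAt
      ((isOpen_coord_mem hφ).mem_nhds hy)).differentiableAt (by simp)
  have h3 := h2.hasFDerivAt.comp y
    ((jetTrunc E (show k ≤ 2 * k - 1 by omega)).hasFDerivAt.comp y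
      (hasFDerivAt_fst (𝕜 := ℝ)))
  refine ⟨_, h1.sub h3, fun v => ?_⟩
  simp

/-- For a vector tangent to the fibres of $\rho^{2k-1}_{k-1}$, both the shift and the truncation to
order $k$ see only the component of order $k$. Hence $dH$ depends on that component alone. -/
theorem single_last_eq_of_jetTrunc_eq_zero {k : ℕ} (hk : 1 ≤ k) {v : Fin (2 * k - 1 + 1) → E}
    (hv : jetTrunc E (show k - 1 ≤ 2 * k - 1 by omega) v = 0) :
    jetShift E (show k - 1 < 2 * k - 1 by omega) v =
        ContinuousLinearMap.single ℝ (fun _ : Fin (k - 1 + 1) => E) (Fin.last (k - 1))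
          (v ⟨k, by omega⟩) ∧
      jetTrunc E (show k ≤ 2 * k - 1 by omega) v =
        ContinuousLinearMap.single ℝ (fun _ : Fin (k + 1) => E) (Fin.last k) (v ⟨k, by omega⟩) := by
  have hv' : ∀ i : Fin (2 * k - 1 + 1), (i : ℕ) < k - 1 + 1 → v i = 0 :=
    fun i hi => congrFun hv ⟨i, hi⟩
  constructor
  · ext i
    rcases eq_or_ne i (Fin.last (k - 1)) with rfl | hi
    · have : ((Fin.last (k - 1)).succ.castLE (by omega) : Fin (2 * k - 1 + 1)) = ⟨k, by omega⟩ := by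
        ext; simp; omega
      rw [jetShift_apply, this]; simp
    · have := Fin.val_lt_last hi
      rw [jetShift_apply, hv' _ (by simp; omega)]; simp [hi]
  · ext i
    rcases eq_or_ne i (Fin.last k) with rfl | hi
    · have : ((Fin.last k).castLE (by omega) : Fin (2 * k - 1 + 1)) = ⟨k, by omega⟩ := by
        ext; simp
      rw [jetTrunc_apply, this]; simp
    · have := Fin.val_lt_last hi
      rw [jetTrunc_apply, hv' _ (by simp; omega)]; simp [hi]

/-- The classical formula $p^{k-1}=\partial L/\partial q_k$, read off from the symbol of $\theta_L$.
-/
theorem legendreCovector_jetFrame_single {k : ℕ} (hk : 1 ≤ k)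
    (L : C^∞⟮jetModel E k, JetBundle E Q k; 𝓘(ℝ, ℝ), ℝ⟯) (hφ : φ ∈ atlas E Q)
    {p : JetBundle E Q (2 * k - 1)} (hp : p.base ∈ φ.source) (e : E) :
    legendreCovector L p (jetFrame φ _
        (ContinuousLinearMap.single ℝ (fun _ : Fin (k - 1 + 1) => E) (Fin.last (k - 1)) e)) =
      fderiv ℝ (coordFun φ L) (jetTrunc E (show k ≤ 2 * k - 1 by omega) (jetCoord _ φ p))
        (ContinuousLinearMap.single ℝ (fun _ : Fin (k + 1) => E) (Fin.last k) e) := by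
  rw [legendreCovector_jetFrame hk L hφ hp]
  obtain ⟨hN, h⟩ := hasSymbol_lagrangianForm hk L hφ
  rw [h _ (jetCoord_mem hφ hp)]
  · rw [jetExtend_apply, dif_pos (by simp)]
    have : (⟨k - 1, by simp⟩ : Fin (k - 1 + 1)) = Fin.last (k - 1) := rfl
    simp [this]
  · intro i hi
    rw [jetExtend_apply, dif_pos (by omega)]
    have : (⟨i, by omega⟩ : Fin (k - 1 + 1)) ≠ Fin.last (k - 1) := by
      intro h; have := congrArg Fin.val h; simp at this; omega
    simp [this]

end UnifiedCoordinates

/-! ### Charts of $W$, the radical of $\Omega$, and $dH$ on it. -/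

section Unified
variable {E : Type*} [NormedAddCommGroup E] [NormedSpace ℝ E]
variable {Q : Type*} [TopologicalSpace Q] [ChartedSpace E Q] [IsManifold 𝓘(ℝ, E) ∞ Q]
variable {φ : OpenPartialHomeomorph Q E} {k : ℕ} {hk : 1 ≤ k}

variable (E) in
/-- The model space of `W`. -/
abbrev UnifiedModelSpace (k : ℕ) :=
  ModelProd (Fin (2 * k - 1 + 1) → E) ((Fin (k - 1 + 1) → E) →L[ℝ] ℝ)

theorem mem_chartAt_unified_source {w₀ w : UnifiedSpace E Q hk} :
    w ∈ (chartAt (UnifiedModelSpace E k) w₀).source ↔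
      w.proj.base ∈ (chartAt E w₀.proj.base).source := by
  rw [FiberBundle.chartedSpace_chartAt]
  simp only [mfld_simps]
  refine ⟨fun h => h.2, fun h => ⟨⟨?_, trivial⟩, h⟩⟩
  change (jetProj E Q _ w.proj).base ∈ (chartAt E (jetProj E Q _ w₀.proj).base).source
  rwa [base_jetProj, base_jetProj]

/-- The covector of a point of `W`. -/
def unifiedCovector (w : UnifiedSpace E Q hk) :
    TangentSpace (jetModel E (k - 1))
      (jetProj E Q (show k - 1 ≤ 2 * k - 1 by omega) w.proj) →L[ℝ] ℝ := w.snd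

theorem chartAt_unified {w₀ w : UnifiedSpace E Q hk}
    (hw : w.proj.base ∈ (chartAt E w₀.proj.base).source) :
    chartAt (UnifiedModelSpace E k) w₀ w =
      (jetCoord (2 * k - 1) (chartAt E w₀.proj.base) w.proj,
        (unifiedCovector w).comp (jetFrame (chartAt E w₀.proj.base) _)) := by
  -- $W$ is a pullback bundle, so its fibre coordinates are those of $T^*(T^{k-1}Q)$ at the image
  -- point.
  have h1 : (chartAt (UnifiedModelSpace E k) w₀ w).2 =
      (chartAt (ModelProd (Fin (k - 1 + 1) → E) ((Fin (k - 1 + 1) → E) →L[ℝ] ℝ))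
        (pr₂ hk w₀) (pr₂ hk w)).2 := by
    rw [FiberBundle.chartedSpace_chartAt, FiberBundle.chartedSpace_chartAt]
    rfl
  have hb : chartAt E (pr₂ hk w₀).proj.base = chartAt E w₀.proj.base := by
    change chartAt E (jetProj E Q _ w₀.proj).base = _
    rw [base_jetProj]
  have hw' : (pr₂ hk w).proj.base ∈ (chartAt E (pr₂ hk w₀).proj.base).source := by
    rw [hb]
    change (jetProj E Q _ w.proj).base ∈ _
    rwa [base_jetProj]
  refine Prod.ext ?_ (h1.trans ?_)
  · rw [FiberBundle.chartedSpace_chartAt]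
    rfl
  · rw [chartAt_momentum hw', hb]
    rfl

theorem chartAt_pr₂ {w₀ w : UnifiedSpace E Q hk}
    (hw : w.proj.base ∈ (chartAt E w₀.proj.base).source) :
    pr₂ hk w ∈ (chartAt (ModelProd (Fin (k - 1 + 1) → E) ((Fin (k - 1 + 1) → E) →L[ℝ] ℝ))
        (pr₂ hk w₀)).source ∧
    chartAt (ModelProd (Fin (k - 1 + 1) → E) ((Fin (k - 1 + 1) → E) →L[ℝ] ℝ))
        (pr₂ hk w₀) (pr₂ hk w) =
      (jetTrunc E (show k - 1 ≤ 2 * k - 1 by omega) (chartAt (UnifiedModelSpace E k) w₀ w).1,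
        (chartAt (UnifiedModelSpace E k) w₀ w).2) := by
  have hb : chartAt E (pr₂ hk w₀).proj.base = chartAt E w₀.proj.base := by
    change chartAt E (jetProj E Q _ w₀.proj).base = _
    rw [base_jetProj]
  have hw' : (pr₂ hk w).proj.base ∈ (chartAt E (pr₂ hk w₀).proj.base).source := by
    rw [hb]
    change (jetProj E Q _ w.proj).base ∈ _
    rwa [base_jetProj]
  refine ⟨mem_chartAt_momentum_source.2 hw', ?_⟩
  rw [chartAt_momentum hw', chartAt_unified hw, hb]
  exact Prod.ext (jetCoord_jetProj _ (chart_mem_atlas E _) hw) rfl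

theorem eventually_mem_chart (w₀ : UnifiedSpace E Q hk) {w : UnifiedSpace E Q hk}
    (hw : w.proj.base ∈ (chartAt E w₀.proj.base).source) :
    ∀ᶠ y in 𝓝 w, y.proj.base ∈ (chartAt E w₀.proj.base).source := by
  filter_upwards [(chartAt (UnifiedModelSpace E k) w₀).open_source.mem_nhds
    (mem_chartAt_unified_source.2 hw)] with y hy
  exact mem_chartAt_unified_source.1 hy

theorem hasMFDerivAt_pr₂ (w : UnifiedSpace E Q hk) :
    HasMFDerivAt (unifiedModel E k) (momentumModel E k) (pr₂ hk) w (coordPr₂ E k) := by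
  refine hasMFDerivAt_of_chart_eq (g := coordPr₂ E k) ?_ (coordPr₂ E k).hasFDerivAt
  filter_upwards [eventually_mem_chart w (mem_chart_source E w.proj.base)] with y hy
  rw [extChartAt_source]
  exact chartAt_pr₂ hy

/-- The analogue of `hasMFDerivAt_pr₂` away from the centre of the chart; it is needed to follow the
kernel of $T\mathrm{pr}_2$ over a whole chart domain. -/
theorem mfderiv_extChartAt_pr₂ {w₀ w : UnifiedSpace E Q hk}
    (hw : w.proj.base ∈ (chartAt E w₀.proj.base).source)
    (u : TangentSpace (unifiedModel E k) w) :
    mfderiv (momentumModel E k) 𝓘(ℝ, (Fin (k - 1 + 1) → E) × ((Fin (k - 1 + 1) → E) →L[ℝ] ℝ))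
        (extChartAt (momentumModel E k) (pr₂ hk w₀)) (pr₂ hk w)
        (mfderiv (unifiedModel E k) (momentumModel E k) (pr₂ hk) w u) =
      coordPr₂ E k (mfderiv (unifiedModel E k) 𝓘(ℝ, (Fin (2 * k - 1 + 1) → E) ×
        ((Fin (k - 1 + 1) → E) →L[ℝ] ℝ)) (extChartAt (unifiedModel E k) w₀) w u) := by
  have h1 := (mdifferentiableAt_extChartAt (I := momentumModel E k)
    (chartAt_pr₂ hw).1).hasMFDerivAt.comp w
    (hasMFDerivAt_pr₂ w).mdifferentiableAt.hasMFDerivAt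
  have h2 := ((coordPr₂ E k).hasMFDerivAt
    (x := extChartAt (unifiedModel E k) w₀ w)).comp w
    (mdifferentiableAt_extChartAt (I := unifiedModel E k)
      (mem_chartAt_unified_source.2 hw)).hasMFDerivAt
  have h3 : (extChartAt (momentumModel E k) (pr₂ hk w₀) ∘ pr₂ hk) =ᶠ[𝓝 w]
      (coordPr₂ E k ∘ extChartAt (unifiedModel E k) w₀) := by
    filter_upwards [eventually_mem_chart w₀ hw] with y hy
    exact (chartAt_pr₂ hy).2
  exact DFunLike.congr_fun (hasMFDerivAt_unique h1 (h2.congr_of_eventuallyEq h3)) u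

theorem unifiedTwoForm_apply (w : UnifiedSpace E Q hk)
    (u v : (Fin (2 * k - 1 + 1) → E) × ((Fin (k - 1 + 1) → E) →L[ℝ] ℝ)) :
    unifiedTwoForm hk w u v =
      v.2 (jetTrunc E (show k - 1 ≤ 2 * k - 1 by omega) u.1) -
        u.2 (jetTrunc E (show k - 1 ≤ 2 * k - 1 by omega) v.1) := by
  unfold unifiedTwoForm
  rw [(hasMFDerivAt_pr₂ w).mfderiv]
  exact canonicalTwoForm_apply _ _ _

/-- Nondegeneracy of $\omega_{k-1}$: pairing with the vectors $(\tilde v,0)$, where $\tilde v$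
extends $v$ by zero, kills the momentum part. Pairing with $(0,a)$ kills the truncated part, since
covectors separate points. -/
theorem unifiedTwoForm_ker_iff (w : UnifiedSpace E Q hk)
    (u : (Fin (2 * k - 1 + 1) → E) × ((Fin (k - 1 + 1) → E) →L[ℝ] ℝ)) :
    (∀ v, unifiedTwoForm hk w u v = 0) ↔ coordPr₂ E k u = 0 := by
  constructor
  · intro h
    have h2 : u.2 = 0 := by
      ext v
      have := (unifiedTwoForm_apply w u (jetExtend E (2 * k - 1) (k - 1) v, 0)).symm.trans (h _)
      rw [jetTrunc_jetExtend] at this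
      simpa using this
    have h1 : jetTrunc E (show k - 1 ≤ 2 * k - 1 by omega) u.1 = 0 := by
      refine SeparatingDual.eq_zero_of_forall_dual_eq_zero (R := ℝ) fun a => ?_
      have := (unifiedTwoForm_apply w u (0, a)).symm.trans (h _)
      simpa using this
    exact Prod.ext h1 h2
  · intro h v
    have h1 : jetTrunc E (show k - 1 ≤ 2 * k - 1 by omega) u.1 = 0 := congrArg Prod.fst h
    have h2 : u.2 = 0 := congrArg Prod.snd h
    refine (unifiedTwoForm_apply w u v).trans ?_
    rw [h1, h2]
    simp

theorem unifiedHamiltonian_eq (L : C^∞⟮jetModel E k, JetBundle E Q k; 𝓘(ℝ, ℝ), ℝ⟯)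
    {w₀ w : UnifiedSpace E Q hk} (hw : w.proj.base ∈ (chartAt E w₀.proj.base).source) :
    unifiedHamiltonian hk L w = coordHamiltonian hk L (chartAt E w₀.proj.base)
      (extChartAt (unifiedModel E k) w₀ w) := by
  have hφ := chart_mem_atlas E w₀.proj.base
  have h1 : extChartAt (unifiedModel E k) w₀ w = _ := chartAt_unified hw
  rw [h1, coordHamiltonian, unifiedHamiltonian, coordFun]
  dsimp only
  rw [← jetCoord_jetProj _ hφ hw, jetOfCoord_jetCoord hφ (by rwa [base_jetProj]),
    ← jetDiff_jetVelocity _ hφ hw]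
  congr 1
  refine (congrArg (unifiedCovector w) ?_ : _ = unifiedCovector w (jetFrame _ _ _))
  exact (jetFrame_jetDiff hφ (by rwa [base_jetProj]) _).symm

/-- The difference between the covector of a point of `W` and the Legendre-Ostrogradsky
covector. -/
def covectorDefect (L : C^∞⟮jetModel E k, JetBundle E Q k; 𝓘(ℝ, ℝ), ℝ⟯)
    (w : UnifiedSpace E Q hk) : TangentSpace (jetModel E (k - 1))
      (jetProj E Q (show k - 1 ≤ 2 * k - 1 by omega) w.proj) →L[ℝ] ℝ :=
  unifiedCovector w - legendreCovector L w.proj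

/-- On the radical only the component $u_k$ matters, and it contributes $(p^{k-1}-\partial
L/\partial q_k)(u_k)$. By the formula for the top momentum this is the defect
$\alpha-\mathcal{FL}(p)$ on the vector $u_k$ in the $q_{k-1}$ direction. -/
theorem mfderiv_unifiedHamiltonian (L : C^∞⟮jetModel E k, JetBundle E Q k; 𝓘(ℝ, ℝ), ℝ⟯)
    (w : UnifiedSpace E Q hk)
    {u : (Fin (2 * k - 1 + 1) → E) × ((Fin (k - 1 + 1) → E) →L[ℝ] ℝ)}
    (hu : coordPr₂ E k u = 0) :
    mfderiv (unifiedModel E k) 𝓘(ℝ, ℝ) (unifiedHamiltonian hk L) w u =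
      covectorDefect L w (jetFrame (chartAt E w.proj.base) _
        (ContinuousLinearMap.single ℝ (fun _ : Fin (k - 1 + 1) => E) (Fin.last (k - 1))
          (u.1 ⟨k, by omega⟩))) := by
  obtain ⟨u, ϖ⟩ := u
  have h1 : jetTrunc E (show k - 1 ≤ 2 * k - 1 by omega) u = 0 := congrArg Prod.fst hu
  obtain rfl : ϖ = 0 := congrArg Prod.snd hu
  have hφ := chart_mem_atlas E w.proj.base
  have hw := mem_chart_source E w.proj.base
  have hc : extChartAt (unifiedModel E k) w w = _ := chartAt_unified hw
  obtain ⟨D, hD, hD'⟩ := hasFDerivAt_coordHamiltonian hk L hφ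
    (y := extChartAt (unifiedModel E k) w w) (by rw [hc]; exact jetCoord_mem hφ hw)
  have hs (z : ℝ) : z ∈ (extChartAt 𝓘(ℝ, ℝ) (unifiedHamiltonian hk L w)).source := by
    rw [extChartAt_model_space_eq_id]; trivial
  have h2 : HasMFDerivAt (unifiedModel E k) 𝓘(ℝ, ℝ) (unifiedHamiltonian hk L) w D := by
    refine hasMFDerivAt_of_chart_eq ?_ hD
    filter_upwards [eventually_mem_chart w hw] with y hy
    exact ⟨hs _, unifiedHamiltonian_eq L hy⟩
  obtain ⟨h3, h4⟩ := single_last_eq_of_jetTrunc_eq_zero hk h1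
  rw [h2.mfderiv]
  refine (hD' u).trans ?_
  rw [h3, h4, hc, ← legendreCovector_jetFrame_single hk L hφ hw]
  rfl

end Unified
end
end SkinnerRusk

namespace SkinnerRusk
noncomputable section

/-! ### Global fields in $\ker\Omega$ and the equation of $W_c$. -/

section KernelFields
variable {E : Type*} [NormedAddCommGroup E] [NormedSpace ℝ E]
variable {Q : Type*} [TopologicalSpace Q] [ChartedSpace E Q] [IsManifold 𝓘(ℝ, E) ∞ Q]
variable {φ : OpenPartialHomeomorph Q E} {k : ℕ} {hk : 1 ≤ k}

theorem contMDiff_base (m : ℕ) :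
    ContMDiff (jetModel E m) 𝓘(ℝ, E) ∞ (JetBundle.base : JetBundle E Q m → Q) := by
  intro p
  have hφ := chart_mem_atlas E p.base
  have hp := mem_chart_source E p.base
  have h1 : ContMDiffAt (jetModel E m) 𝓘(ℝ, E) ∞
      (fun x => jetCoord m (chartAt E p.base) x 0) p :=
    (ContinuousLinearMap.proj (R := ℝ) (φ := fun _ : Fin (m + 1) => E) 0).contMDiff.contMDiffAt.comp
      p ((contMDiffOn_jetCoord m hφ).contMDiffAt ((isOpen_base_mem hφ).mem_nhds hp))
  have h2 := (contMDiffOn_symm_of_mem_maximalAtlas (I := 𝓘(ℝ, E)) (n := ∞)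
    (IsManifold.subset_maximalAtlas hφ)).contMDiffAt
    ((chartAt E p.base).open_target.mem_nhds (jetCoord_mem hφ hp))
  refine (ContMDiffAt.comp p h2 h1).congr_of_eventuallyEq ?_
  filter_upwards [(isOpen_base_mem hφ).mem_nhds hp] with x hx
  have h0 : jetCoord m (chartAt E p.base) x 0 = chartAt E p.base x.base := by
    simp [jetCoord, JetBundle.base]
  rw [Function.comp_apply, h0, (chartAt E p.base).left_inv hx]

/-- The vector field on `W` which is constant, equal to `y`, in the preferred chart at `w₀`. -/
def coordField (w₀ : UnifiedSpace E Q hk)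
    (y : (Fin (2 * k - 1 + 1) → E) × ((Fin (k - 1 + 1) → E) →L[ℝ] ℝ))
    (w : UnifiedSpace E Q hk) : TangentSpace (unifiedModel E k) w :=
  (trivializationAt ((Fin (2 * k - 1 + 1) → E) × ((Fin (k - 1 + 1) → E) →L[ℝ] ℝ))
    (TangentSpace (unifiedModel E k)) w₀).symmL ℝ w y

theorem mem_trivializationAt_baseSet {w₀ w : UnifiedSpace E Q hk}
    (hw : w.proj.base ∈ (chartAt E w₀.proj.base).source) :
    w ∈ (trivializationAt ((Fin (2 * k - 1 + 1) → E) × ((Fin (k - 1 + 1) → E) →L[ℝ] ℝ))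
      (TangentSpace (unifiedModel E k)) w₀).baseSet :=
  mem_chartAt_unified_source.2 hw

theorem mfderiv_extChartAt_coordField {w₀ w : UnifiedSpace E Q hk}
    (hw : w.proj.base ∈ (chartAt E w₀.proj.base).source)
    (y : (Fin (2 * k - 1 + 1) → E) × ((Fin (k - 1 + 1) → E) →L[ℝ] ℝ)) :
    mfderiv (unifiedModel E k) 𝓘(ℝ, (Fin (2 * k - 1 + 1) → E) ×
      ((Fin (k - 1 + 1) → E) →L[ℝ] ℝ)) (extChartAt (unifiedModel E k) w₀) w
      (coordField w₀ y w) = y := by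
  have h1 := TangentBundle.continuousLinearMapAt_trivializationAt (I := unifiedModel E k)
    (x₀ := w₀) (x := w) (mem_chartAt_unified_source.2 hw)
  have h2 := (trivializationAt ((Fin (2 * k - 1 + 1) → E) × ((Fin (k - 1 + 1) → E) →L[ℝ] ℝ))
    (TangentSpace (unifiedModel E k)) w₀).continuousLinearMapAt_symmL (R := ℝ)
      (mem_trivializationAt_baseSet hw) y
  rw [h1] at h2
  exact h2

theorem coordField_self (w : UnifiedSpace E Q hk)
    (y : (Fin (2 * k - 1 + 1) → E) × ((Fin (k - 1 + 1) → E) →L[ℝ] ℝ)) :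
    coordField w y w = y := by
  have h := mfderiv_extChartAt_coordField (mem_chart_source E w.proj.base) y
  rw [mfderiv_extChartAt_self] at h
  exact h

theorem contMDiffOn_coordField (w₀ : UnifiedSpace E Q hk)
    (y : (Fin (2 * k - 1 + 1) → E) × ((Fin (k - 1 + 1) → E) →L[ℝ] ℝ)) :
    ContMDiffOn (unifiedModel E k) (unifiedModel E k).tangent ∞
      (fun w => (⟨w, coordField w₀ y w⟩ : TangentBundle (unifiedModel E k) (UnifiedSpace E Q hk)))
      (chartAt (UnifiedModelSpace E k) w₀).source := by
  set e := trivializationAt ((Fin (2 * k - 1 + 1) → E) × ((Fin (k - 1 + 1) → E) →L[ℝ] ℝ))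
    (TangentSpace (unifiedModel E k)) w₀ with he
  have h := (Bundle.Trivialization.contMDiffOn_symm (IB := unifiedModel E k) (n := ∞) e).comp
    (contMDiffOn_id.prodMk (contMDiffOn_const (c := y)) :
      ContMDiffOn (unifiedModel E k) ((unifiedModel E k).prod 𝓘(ℝ, _)) ∞
        (fun w : UnifiedSpace E Q hk => (w, y)) (chartAt (UnifiedModelSpace E k) w₀).source)
    (fun w hw => e.mem_target.2 hw)
  refine h.congr fun w hw => ?_
  have hw' : w ∈ e.baseSet := hw
  change (⟨w, e.symmL ℝ w y⟩ : TotalSpace _ _) = e.toOpenPartialHomeomorph.symm (w, y)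
  rw [← e.mk_symm hw', e.symmL_apply hw']

/-- A field that is constant in a chart stays in the radical if it starts there: $T\mathrm{pr}_2$ is
the constant map `coordPr₂` in these charts, and the differential of the chart of $T^*(T^{k-1}Q)$ is
injective. -/
theorem mfderiv_pr₂_coordField {w₀ w : UnifiedSpace E Q hk}
    (hw : w.proj.base ∈ (chartAt E w₀.proj.base).source)
    {y : (Fin (2 * k - 1 + 1) → E) × ((Fin (k - 1 + 1) → E) →L[ℝ] ℝ)}
    (hy : coordPr₂ E k y = 0) : coordPr₂ E k (coordField w₀ y w) = 0 := by
  have h1 := mfderiv_extChartAt_pr₂ hw (coordField w₀ y w)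
  rw [mfderiv_extChartAt_coordField hw, hy, (hasMFDerivAt_pr₂ w).mfderiv] at h1
  have h2 : (pr₂ hk w) ∈ (extChartAt (momentumModel E k) (pr₂ hk w₀)).source := by
    rw [extChartAt_source]; exact (chartAt_pr₂ hw).1
  have h3 := (isInvertible_mfderiv_extChartAt h2).injective
  exact h3 (h1.trans (ContinuousLinearMap.map_zero _).symm)

/-- The local constant field is cut off by a bump function on $Q$ pulled back to $W$. This suffices
because the chart domains of $W$ are preimages of chart domains of $Q$; multiplying by a function
keeps the field in the kernel. -/
theorem exists_kernelField [FiniteDimensional ℝ E] [T2Space Q] (w₀ : UnifiedSpace E Q hk)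
    {y : (Fin (2 * k - 1 + 1) → E) × ((Fin (k - 1 + 1) → E) →L[ℝ] ℝ)}
    (hy : coordPr₂ E k y = 0) : ∃ Y : KernelField E Q hk, Y.toFun w₀ = y := by
  obtain ⟨f⟩ : Nonempty (SmoothBumpFunction 𝓘(ℝ, E) w₀.proj.base) := inferInstance
  let b : UnifiedSpace E Q hk → Q := fun w => w.proj.base
  have hb : ContMDiff (unifiedModel E k) 𝓘(ℝ, E) ∞ b :=
    (contMDiff_base _).comp (Bundle.contMDiff_proj _)
  have hsupp : tsupport (f ∘ b) ⊆ (chartAt (UnifiedModelSpace E k) w₀).source := by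
    intro w hw
    have := tsupport_comp_subset_preimage f hb.continuous hw
    exact mem_chartAt_unified_source.2 (f.tsupport_subset_chartAt_source this)
  refine ⟨⟨fun w => f (b w) • (coordField w₀ y w : (Fin (2 * k - 1 + 1) → E) ×
    ((Fin (k - 1 + 1) → E) →L[ℝ] ℝ)), ?_, ?_⟩, ?_⟩
  · exact ContMDiffOn.smul_section_of_tsupport (f.contMDiff.comp hb).contMDiffOn
      (chartAt (UnifiedModelSpace E k) w₀).open_source hsupp (contMDiffOn_coordField w₀ y)
  · intro w
    refine (unifiedTwoForm_ker_iff w _).2 ?_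
    refine ((coordPr₂ E k).map_smul (f (b w)) _).trans ?_
    by_cases hw : w.proj.base ∈ (chartAt E w₀.proj.base).source
    · exact smul_eq_zero_of_right _ (mfderiv_pr₂_coordField hw hy)
    · exact smul_eq_zero_of_left (by_contra fun h => hw (f.support_subset_source h)) _
  · change f w₀.proj.base • (coordField w₀ y w₀ : (Fin (2 * k - 1 + 1) → E) ×
      ((Fin (k - 1 + 1) → E) →L[ℝ] ℝ)) = y
    rw [f.eq_one, one_smul, coordField_self]

theorem jetFrame_coordVertical {m : ℕ} (r : ℕ) (hφ : φ ∈ atlas E Q) {p : JetBundle E Q m}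
    (hp : p.base ∈ φ.source) (v : Fin (m + 1) → E) :
    jetFrame φ p (coordVertical E m r v) = verticalEndomorphism m r p (jetFrame φ p v) := by
  apply jetDiff_injective hφ hp
  rw [jetDiff_jetFrame hφ hp, jetDiff_verticalEndomorphism r hφ hp, jetDiff_jetFrame hφ hp]

/-- The image of $J_m$ consists of the vertical vectors of highest order, which gives these a
chart-free description. -/
theorem coordVertical_self (m : ℕ) (v : Fin (m + 1) → E) :
    coordVertical E m m v = ContinuousLinearMap.single ℝ (fun _ : Fin (m + 1) => E) (Fin.last m)
      ((m.factorial : ℝ) • v 0) := by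
  ext i
  rw [coordVertical_apply]
  rcases eq_or_ne i (Fin.last m) with rfl | hi
  · rw [if_pos (by simp)]
    have : (⟨((Fin.last m : Fin (m + 1)) : ℕ) - m, by simp⟩ : Fin (m + 1)) = 0 := by ext; simp
    rw [this]
    simp
  · rw [if_neg (by have := Fin.val_lt_last hi; omega)]
    simp [hi]

/-- Whether a covector annihilates the vertical vectors of highest order does not depend on the
natural coordinates. -/
theorem forall_jetFrame_single_iff {m : ℕ} (hφ : φ ∈ atlas E Q) {p : JetBundle E Q m}
    (hp : p.base ∈ φ.source) (a : TangentSpace (jetModel E m) p →L[ℝ] ℝ) :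
    (∀ e, a (jetFrame φ p (ContinuousLinearMap.single ℝ (fun _ : Fin (m + 1) => E)
      (Fin.last m) e)) = 0) ↔ ∀ u, a (verticalEndomorphism m m p u) = 0 := by
  constructor
  · intro h u
    rw [← jetFrame_jetDiff hφ hp u, ← jetFrame_coordVertical m hφ hp, coordVertical_self]
    exact h _
  · intro h e
    -- $J_m$ multiplies the component of order zero by $m!$, hence the inverse factorial.
    have h1 := h (jetFrame φ p fun _ => ((m.factorial : ℝ)⁻¹ • e))
    have hm : (m.factorial : ℝ) ≠ 0 := by exact_mod_cast m.factorial_ne_zero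
    rwa [← jetFrame_coordVertical m hφ hp, coordVertical_self, smul_smul, mul_inv_cancel₀ hm,
      one_smul] at h1

/-- Each value of the $q_k$ component is attained by some kernel field, and $dH$ on the radical sees
nothing else. The condition is computed in the preferred chart at $w$ and carried to $\varphi$
through the image of $J_{k-1}$. -/
theorem mem_compatibilitySet_iff [FiniteDimensional ℝ E] [T2Space Q]
    (L : C^∞⟮jetModel E k, JetBundle E Q k; 𝓘(ℝ, ℝ), ℝ⟯)
    (hφ : φ ∈ atlas E Q) {w : UnifiedSpace E Q hk} (hw : w.proj.base ∈ φ.source) :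
    w ∈ compatibilitySet hk L ↔ ∀ e, covectorDefect L w (jetFrame φ _
      (ContinuousLinearMap.single ℝ (fun _ : Fin (k - 1 + 1) => E) (Fin.last (k - 1)) e)) = 0 := by
  have hb : (jetProj E Q (show k - 1 ≤ 2 * k - 1 by omega) w.proj).base = w.proj.base :=
    base_jetProj _ _
  rw [forall_jetFrame_single_iff hφ (by rwa [hb]),
    ← forall_jetFrame_single_iff (chart_mem_atlas E w.proj.base)
      (by rw [hb]; exact mem_chart_source E _)]
  constructor
  · intro h e
    -- The direction $e\,\partial/\partial q_k$: its order $k$ is the first one that the truncation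
    -- to $T^{k-1}Q$ forgets.
    let v : Fin (2 * k - 1 + 1) → E := Pi.single ⟨k, by omega⟩ e
    have hy : coordPr₂ E k (v, 0) = 0 := by
      refine Prod.ext ?_ rfl
      ext i
      change v (i.castLE _) = 0
      refine Pi.single_eq_of_ne ?_ _
      intro hi
      have := congrArg Fin.val hi
      have hi' := i.2
      simp at this
      omega
    obtain ⟨Y, hY⟩ := exists_kernelField w hy
    have h1 := h Y
    rw [hY] at h1
    have h2 := (mfderiv_unifiedHamiltonian L w hy).symm.trans h1
    have hv : v ⟨k, by omega⟩ = e := Pi.single_eq_same _ _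
    dsimp only at h2
    rwa [hv] at h2
  · intro h Y
    have h1 := (unifiedTwoForm_ker_iff w (Y.toFun w)).1 (Y.mem_ker w)
    exact (mfderiv_unifiedHamiltonian L w h1).trans (h _)

end KernelFields
end
end SkinnerRusk

namespace SkinnerRusk
noncomputable section

/-! ### Shears as smooth changes of chart. -/

section Shear
variable {V W : Type*} [NormedAddCommGroup V] [NormedSpace ℝ V] [NormedAddCommGroup W]
  [NormedSpace ℝ W]

/-- The shear `(q, π) ↦ (q, π - F q)` over an open set. -/
def shear {U : Set V} (hU : IsOpen U) {F : V → W} (hF : ContinuousOn F U) :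
    OpenPartialHomeomorph (V × W) (V × W) where
  toFun y := (y.1, y.2 - F y.1)
  invFun y := (y.1, y.2 + F y.1)
  source := Prod.fst ⁻¹' U
  target := Prod.fst ⁻¹' U
  map_source' _ h := h
  map_target' _ h := h
  left_inv' _ _ := by simp
  right_inv' _ _ := by simp
  open_source := hU.preimage continuous_fst
  open_target := hU.preimage continuous_fst
  continuousOn_toFun := continuousOn_fst.prodMk
    (continuousOn_snd.sub (hF.comp continuousOn_fst fun _ h => h))
  continuousOn_invFun := continuousOn_fst.prodMk
    (continuousOn_snd.add (hF.comp continuousOn_fst fun _ h => h))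

theorem shear_mem_contDiffGroupoid {U : Set V} (hU : IsOpen U) {F : V → W}
    (hF : ContDiffOn ℝ ∞ F U) :
    (shear hU hF.continuousOn : OpenPartialHomeomorph (ModelProd V W) (ModelProd V W)) ∈
      contDiffGroupoid ∞ (𝓘(ℝ, V).prod 𝓘(ℝ, W)) := by
  have h1 : ContDiffOn ℝ ∞ (fun y : V × W => F y.1) (Prod.fst ⁻¹' U) :=
    hF.comp contDiffOn_fst fun _ h => h
  refine mem_groupoid_of_pregroupoid.2 ⟨?_, ?_⟩
  · exact ContDiffOn.mono (contDiffOn_fst.prodMk (contDiffOn_snd.sub h1)) inter_subset_left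
  · exact ContDiffOn.mono (contDiffOn_fst.prodMk (contDiffOn_snd.add h1)) inter_subset_left

theorem trans_mem_maximalAtlas {H M : Type*} [TopologicalSpace H] [TopologicalSpace M]
    [ChartedSpace H M] {G : StructureGroupoid H} {e : OpenPartialHomeomorph M H}
    (he : e ∈ G.maximalAtlas M) {s : OpenPartialHomeomorph H H} (hs : s ∈ G) :
    e.trans s ∈ G.maximalAtlas M := by
  rw [mem_maximalAtlas_iff] at he ⊢
  intro e' he'
  obtain ⟨h1, h2⟩ := he e' he'
  constructor
  · rw [OpenPartialHomeomorph.trans_symm_eq_symm_trans_symm, OpenPartialHomeomorph.trans_assoc]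
    exact G.trans (G.symm hs) h1
  · rw [← OpenPartialHomeomorph.trans_assoc]
    exact G.trans h2 hs

end Shear

/-! ### Adapted charts for $W_c$ and the graph. -/

section Submanifolds
variable {E : Type*} [NormedAddCommGroup E] [NormedSpace ℝ E]
variable {Q : Type*} [TopologicalSpace Q] [ChartedSpace E Q] [IsManifold 𝓘(ℝ, E) ∞ Q]
variable {k : ℕ} {hk : 1 ≤ k}

/-- In suitable charts, the last component of a point of `W` is the difference of its covector and
the Legendre covector. -/
theorem exists_chart_covectorDefect (L : C^∞⟮jetModel E k, JetBundle E Q k; 𝓘(ℝ, ℝ), ℝ⟯)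
    (w₀ : UnifiedSpace E Q hk) :
    ∃ e ∈ IsManifold.maximalAtlas (unifiedModel E k) ∞ (UnifiedSpace E Q hk), w₀ ∈ e.source ∧
      ∃ φ ∈ atlas E Q, ∀ y ∈ e.source, y.proj.base ∈ φ.source ∧
        (e.extend (unifiedModel E k) y).2 = (covectorDefect L y).comp (jetFrame φ _) := by
  have hφ := chart_mem_atlas E w₀.proj.base
  have hF : ContDiffOn ℝ ∞ (fun q : Fin (2 * k - 1 + 1) → E =>
      (coordForm (chartAt E w₀.proj.base) (lagrangianForm L) q).comp
        (jetExtend E (2 * k - 1) (k - 1))) {q | q 0 ∈ (chartAt E w₀.proj.base).target} :=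
    (isSmoothForm_lagrangianForm L _ hφ).clm_comp contDiffOn_const
  refine ⟨(chartAt (UnifiedModelSpace E k) w₀).trans (shear (isOpen_coord_mem hφ) hF.continuousOn),
    trans_mem_maximalAtlas (IsManifold.chart_mem_maximalAtlas w₀)
      (shear_mem_contDiffGroupoid _ hF), ?_, _, hφ, fun y hy => ?_⟩
  · have h := mem_chart_source E w₀.proj.base
    refine ⟨mem_chart_source _ w₀, ?_⟩
    change (chartAt (UnifiedModelSpace E k) w₀ w₀).1 0 ∈ (chartAt E w₀.proj.base).target
    rw [chartAt_unified h]
    exact jetCoord_mem hφ h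
  · have h := mem_chartAt_unified_source.1 hy.1
    refine ⟨h, ?_⟩
    change (chartAt (UnifiedModelSpace E k) w₀ y).2 -
      (coordForm (chartAt E w₀.proj.base) (lagrangianForm L)
        (chartAt (UnifiedModelSpace E k) w₀ y).1).comp (jetExtend E (2 * k - 1) (k - 1)) = _
    rw [chartAt_unified h]
    ext v
    exact congrArg (fun t => unifiedCovector y (jetFrame _ _ v) - t)
      (legendreCovector_jetFrame hk L hφ h v).symm

variable (E) in
/-- The covectors which annihilate the vertical vectors of highest order. -/
def annihilatorLast (m : ℕ) : Submodule ℝ ((Fin (m + 1) → E) →L[ℝ] ℝ) where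
  carrier := {a | ∀ e, a (ContinuousLinearMap.single ℝ (fun _ : Fin (m + 1) => E)
    (Fin.last m) e) = 0}
  add_mem' h h' e := by rw [add_apply, h e, h' e, add_zero]
  zero_mem' _ := rfl
  smul_mem' c _ h e := by rw [smul_apply, h e, smul_zero]

theorem mem_annihilatorLast {m : ℕ} {a : (Fin (m + 1) → E) →L[ℝ] ℝ} :
    a ∈ annihilatorLast E m ↔ ∀ e, a (ContinuousLinearMap.single ℝ (fun _ : Fin (m + 1) => E)
      (Fin.last m) e) = 0 := Iff.rfl

theorem mem_graphIn_legendreMap_iff (L : C^∞⟮jetModel E k, JetBundle E Q k; 𝓘(ℝ, ℝ), ℝ⟯)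
    (w : UnifiedSpace E Q hk) : w ∈ graphIn hk (legendreMap L) ↔ covectorDefect L w = 0 := by
  rw [covectorDefect, sub_eq_zero]
  exact TotalSpace.mk_inj

theorem graphIn_legendreMap_subset [FiniteDimensional ℝ E] [T2Space Q]
    (L : C^∞⟮jetModel E k, JetBundle E Q k; 𝓘(ℝ, ℝ), ℝ⟯) :
    graphIn hk (legendreMap L) ⊆ compatibilitySet hk L := by
  intro w hw
  rw [mem_graphIn_legendreMap_iff] at hw
  rw [mem_compatibilitySet_iff L (chart_mem_atlas E w.proj.base) (mem_chart_source E w.proj.base)]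
  intro e
  rw [hw]
  rfl

/-- After the shear the fibre coordinate is the defect $\alpha-\mathcal{FL}(p)$. The graph is its
vanishing and $W_c$ its vanishing on the top vertical directions, so one chart straightens both. -/
theorem exists_adapted_chart [FiniteDimensional ℝ E] [T2Space Q]
    (L : C^∞⟮jetModel E k, JetBundle E Q k; 𝓘(ℝ, ℝ), ℝ⟯) (w₀ : UnifiedSpace E Q hk) :
    ∃ e ∈ IsManifold.maximalAtlas (unifiedModel E k) ∞ (UnifiedSpace E Q hk), w₀ ∈ e.source ∧
      (∀ y ∈ e.source, y ∈ graphIn hk (legendreMap L) ↔ e.extend (unifiedModel E k) y ∈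
        (⊤ : Submodule ℝ (Fin (2 * k - 1 + 1) → E)).prod
          (⊥ : Submodule ℝ ((Fin (k - 1 + 1) → E) →L[ℝ] ℝ))) ∧
      ∀ y ∈ e.source, y ∈ compatibilitySet hk L ↔ e.extend (unifiedModel E k) y ∈
        (⊤ : Submodule ℝ (Fin (2 * k - 1 + 1) → E)).prod (annihilatorLast E (k - 1)) := by
  obtain ⟨e, he, hw₀, φ, hφ, h⟩ := exists_chart_covectorDefect L w₀
  refine ⟨e, he, hw₀, fun y hy => ?_, fun y hy => ?_⟩ <;> obtain ⟨hb, h2⟩ := h y hy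
  · rw [mem_graphIn_legendreMap_iff, Submodule.mem_prod, h2, Submodule.mem_bot]
    refine ⟨fun h => ⟨trivial, by rw [h]; rfl⟩, fun h => ?_⟩
    ext u
    have hb' : (jetProj E Q (show k - 1 ≤ 2 * k - 1 by omega) y.proj).base ∈ φ.source := by
      rwa [base_jetProj]
    rw [← jetFrame_jetDiff hφ hb' u]
    exact DFunLike.congr_fun h.2 _
  · rw [mem_compatibilitySet_iff L hφ hb, Submodule.mem_prod, h2, mem_annihilatorLast]
    exact ⟨fun h => ⟨trivial, h⟩, fun h => h.2⟩

theorem isEmbeddedSubmanifold_compatibilitySet [FiniteDimensional ℝ E] [T2Space Q]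
    (L : C^∞⟮jetModel E k, JetBundle E Q k; 𝓘(ℝ, ℝ), ℝ⟯) :
    IsEmbeddedSubmanifold (unifiedModel E k) (compatibilitySet hk L) := by
  -- The model subspace is the same in every adapted chart, so one dimension serves all points.
  refine ⟨Module.finrank ℝ ((⊤ : Submodule ℝ (Fin (2 * k - 1 + 1) → E)).prod
    (annihilatorLast E (k - 1))), fun w _ => ?_⟩
  obtain ⟨e, he, hw, -, h⟩ := exists_adapted_chart L w
  exact ⟨e, he, hw, _, rfl, h⟩

theorem isEmbeddedSubmanifoldOf_graphIn_legendreMap [FiniteDimensional ℝ E] [T2Space Q]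
    (L : C^∞⟮jetModel E k, JetBundle E Q k; 𝓘(ℝ, ℝ), ℝ⟯) :
    IsEmbeddedSubmanifoldOf (unifiedModel E k) (graphIn hk (legendreMap L))
      (compatibilitySet hk L) := by
  refine ⟨graphIn_legendreMap_subset L,
    Module.finrank ℝ ((⊤ : Submodule ℝ (Fin (2 * k - 1 + 1) → E)).prod
      (⊥ : Submodule ℝ ((Fin (k - 1 + 1) → E) →L[ℝ] ℝ))), fun w _ => ?_⟩
  obtain ⟨e, he, hw, h1, h2⟩ := exists_adapted_chart L w
  exact ⟨e, he, hw, _, _, Submodule.prod_mono le_rfl bot_le, rfl, h1, h2⟩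

end Submanifolds
end
end SkinnerRusk

theorem mainTheorem5 {E : Type*} [NormedAddCommGroup E] [NormedSpace ℝ E] [FiniteDimensional ℝ E]
    {Q : Type*} [TopologicalSpace Q] [T2Space Q] [ChartedSpace E Q] [IsManifold 𝓘(ℝ, E) ∞ Q]
    {k : ℕ} (hk : 1 ≤ k) (L : C^∞⟮jetModel E k, JetBundle E Q k; 𝓘(ℝ, ℝ), ℝ⟯) :
    IsEmbeddedSubmanifold (unifiedModel E k) (compatibilitySet hk L) ∧
    ∃ FL : JetBundle E Q (2 * k - 1) → MomentumSpace E Q k,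
      IsLegendreOstrogradskyMap hk L FL ∧
      (∀ F : JetBundle E Q (2 * k - 1) → MomentumSpace E Q k,
        IsLegendreOstrogradskyMap hk L F → F = FL) ∧
      ContMDiff (jetModel E (2 * k - 1)) (momentumModel E k) ∞ FL ∧
      IsEmbeddedSubmanifoldOf (unifiedModel E k) (graphIn hk FL) (compatibilitySet hk L) :=
  ⟨isEmbeddedSubmanifold_compatibilitySet L, legendreMap L,
    isLegendreOstrogradskyMap_legendreMap hk L, fun _ hF => hF.eq_legendreMap,
    contMDiff_legendreMap hk L, isEmbeddedSubmanifoldOf_graphIn_legendreMap L⟩
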